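/- Let $R$ be an associative ring with unit. All functors are additive. Let $\mathrm{Mod}(R)$ be the category of right $R$-modules and $\mathrm{mod}(R^{op})$ the category of finitely presented left $R$-modules. Let $\mathrm{fp}(\mathrm{Mod}(R),\mathrm{Ab})$ be the category of functors $F:\mathrm{Mod}(R)\to\mathrm{Ab}$ that admit a presentation $(Y,-)\to(X,-)\to F\to 0$ with $X,Y\in\mathrm{Mod}(R)$, exact at every module, where $(X,-)=\mathrm{Hom}_R(X,-)$; let $(\mathrm{mod}(R^{op}),\mathrm{Ab})$ be the category of all functors $\mathrm{mod}(R^{op})\to\mathrm{Ab}$. In both categories exactness is tested objectwise. Let $t(M)=M\otimes_R -$ be the tensor embedding $\mathrm{Mod}(R)\to(\mathrm{mod}(R^{op}),\mathrm{Ab})$, and let $w:\mathrm{fp}(\mathrm{Mod}(R),\mathrm{Ab})\to\mathrm{Mod}(R)$ be the contravariant functor for which a presentation $(Y,-)\to(X,-)\to F\to0$ gives an exact sequence $0\to w(F)\to X\to Y$. Let $\mathsf D_A=R_0(t\circ w):\mathrm{fp}(\mathrm{Mod}(R),\mathrm{Ab})\to(\mathrm{mod}(R^{op}),\mathrm{Ab})$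 be the zeroth right derived functor of the contravariant functor $t\circ w$, computed by projective presentations; thus $\mathsf D_A F\cong\ker(X\otimes-\to Y\otimes-)$. Let $\mathsf D_R$ be the contravariant functor on $(\mathrm{mod}(R^{op}),\mathrm{Ab})$ given by $(\mathsf D_R G)(M)=\mathrm{Nat}(G,M\otimes_R-)$. Then every $\mathsf D_R G$ is finitely presented, and $\mathsf D_R:(\mathrm{mod}(R^{op}),\mathrm{Ab})^{op}\to\mathrm{fp}(\mathrm{Mod}(R),\mathrm{Ab})$ is right adjoint to $\mathsf D_A:\mathrm{fp}(\mathrm{Mod}(R),\mathrm{Ab})\to(\mathrm{mod}(R^{op}),\mathrm{Ab})^{op}$. Let $\delta$ be the unit of any such adjunction. Then there is, for every $F\in\mathrm{fp}(\mathrm{Mod}(R),\mathrm{Ab})$, an exact sequence in $\mathrm{fp}(\mathrm{Mod}(R),\mathrm{Ab})$ $$0\longrightarrow F_q\longrightarrow F\xrightarrow{\ \delta_F\ }\mathsf D_R\mathsf D_A F\longrightarrow F^q\longrightarrow 0,$$ functorial in $F$ (that is, $F\mapsto F_q$ and $F\mapsto F^q$ are functors and all the maps are natural in $F$). Moreover $\mathsf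 D_A(F_q)\cong\mathsf D_A(F^q)\cong 0$, and $F_q$ and $F^q$ both arise from pure exact sequences: for each $E\in\{F_q,F^q\}$ there are a short exact sequence of right modules $0\to X\to Y\to Z\to0$ such that $0\to X\otimes_R L\to Y\otimes_R L\to Z\otimes_R L\to0$ is exact for every finitely presented left module $L$, and an exact sequence $0\to(Z,-)\to(Y,-)\to(X,-)\to E\to0$. -/

import Mathlib

open CategoryTheory CategoryTheory.Limits Opposite
open scoped TensorProduct

universe u v₁ u₁ v₂ u₂

namespace AGJ

noncomputable section

/-! ### Finitely presented functors -/

section FinitelyPresented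

variable {C : Type u₁} [Category.{v₁} C] [Preadditive C]

/-- A presentation `(Y, -) ⟶ (X, -) ⟶ F ⟶ 0`, exact at every object. By the Yoneda lemma the
natural transformation `(Y, -) ⟶ (X, -)` is `(f, -)` for a unique morphism `f : X ⟶ Y`. -/
structure Presentation (F : C ⥤ AddCommGrpCat.{v₁}) where
  X : C
  Y : C
  f : X ⟶ Y
  π : preadditiveCoyoneda.obj (op X) ⟶ F
  exact : ∀ A : C,
    Function.Exact ((preadditiveCoyoneda.map f.op).app A) (π.app A)
  surj : ∀ A : C, Function.Surjective (π.app A)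

/-- The functor `F` is finitely presented. Such a functor is automatically additive,
see `IsFP.additive`. -/
def IsFP : ObjectProperty (C ⥤ AddCommGrpCat.{v₁}) := fun F ↦ Nonempty (Presentation F)

variable (C) in
/-- The category `fp(C, Ab)` of finitely presented functors and natural transformations. -/
abbrev FP := (IsFP (C := C)).FullSubcategory

namespace Presentation

variable {F F' F'' : C ⥤ AddCommGrpCat.{v₁}}

/-- The universal element of `F` at `X`. -/
def elt (P : Presentation F) : F.obj P.X := P.π.app P.X (𝟙 P.X)

lemma π_apply (P : Presentation F) {A : C} (a : P.X ⟶ A) : P.π.app A a = F.map a P.elt := by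
  have h := ConcreteCategory.congr_hom (P.π.naturality a) (𝟙 P.X)
  have h2 : (preadditiveCoyoneda.obj (op P.X)).map a (𝟙 P.X) = a := Category.id_comp a
  exact (congrArg (P.π.app A) h2).symm.trans h

lemma exists_map_elt (P : Presentation F) {A : C} (x : F.obj A) :
    ∃ a : P.X ⟶ A, F.map a P.elt = x := by
  obtain ⟨a, ha⟩ := P.surj A x
  exact ⟨a, (P.π_apply a).symm.trans ha⟩

lemma map_add_elt (P : Presentation F) {A : C} (a b : P.X ⟶ A) :
    F.map (a + b) P.elt = F.map a P.elt + F.map b P.elt := by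
  rw [← P.π_apply, ← P.π_apply, ← P.π_apply]
  exact map_add (P.π.app A).hom _ _

lemma map_f_elt (P : Presentation F) : F.map P.f P.elt = 0 := by
  rw [← P.π_apply]
  refine (P.exact P.Y _).2 ⟨𝟙 P.Y, ?_⟩
  exact Category.comp_id P.f

lemma exists_of_map_elt_eq_zero (P : Presentation F) {A : C} (a : P.X ⟶ A)
    (h : F.map a P.elt = 0) : ∃ b : P.Y ⟶ A, P.f ≫ b = a := by
  rw [← P.π_apply] at h
  exact (P.exact A a).1 h

/-- The morphism `a : X' ⟶ X` induces a lift `(a, -) : (X, -) ⟶ (X', -)` of `φ : F ⟶ F'` to the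
chosen presentations. -/
def IsLift (P : Presentation F) (P' : Presentation F') (φ : F ⟶ F') (a : P'.X ⟶ P.X) : Prop :=
  F'.map a P'.elt = φ.app P.X P.elt

lemma exists_isLift (P : Presentation F) (P' : Presentation F') (φ : F ⟶ F') :
    ∃ a, IsLift P P' φ a :=
  P'.exists_map_elt (φ.app P.X P.elt)

lemma IsLift.exists_comm {P : Presentation F} {P' : Presentation F'} {φ : F ⟶ F'}
    {a : P'.X ⟶ P.X} (h : IsLift P P' φ a) : ∃ b : P'.Y ⟶ P.Y, P'.f ≫ b = a ≫ P.f := by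
  apply P'.exists_of_map_elt_eq_zero
  have h1 : F'.map (a ≫ P.f) P'.elt = F'.map P.f (F'.map a P'.elt) := by simp
  have h2 : F'.map P.f (φ.app P.X P.elt) = φ.app P.Y (F.map P.f P.elt) :=
    (ConcreteCategory.congr_hom (φ.naturality P.f) P.elt).symm
  rw [h1, h, h2, P.map_f_elt, map_zero]

end Presentation

lemma IsFP.additive {F : C ⥤ AddCommGrpCat.{v₁}} (hF : IsFP F) : F.Additive := by
  obtain ⟨P⟩ := hF
  refine ⟨fun {A B g h} ↦ ?_⟩
  ext x
  obtain ⟨a, rfl⟩ := P.exists_map_elt x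
  have key (k : A ⟶ B) : F.map k (F.map a P.elt) = F.map (a ≫ k) P.elt := by simp
  have key2 : (F.map g + F.map h) (F.map a P.elt) =
      F.map g (F.map a P.elt) + F.map h (F.map a P.elt) := rfl
  rw [key2, key, key, key, Preadditive.comp_add, P.map_add_elt]

lemma Presentation.IsLift.ext {F F' : C ⥤ AddCommGrpCat.{v₁}} {P : Presentation F}
    {P' : Presentation F'} {φ : F ⟶ F'} {a a' : P'.X ⟶ P.X} (h : IsLift P P' φ a)
    (h' : IsLift P P' φ a') : ∃ b : P'.Y ⟶ P.X, P'.f ≫ b = a - a' := by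
  have := IsFP.additive ⟨P'⟩
  apply P'.exists_of_map_elt_eq_zero
  rw [Functor.map_sub]
  have : (F'.map a - F'.map a') P'.elt = F'.map a P'.elt - F'.map a' P'.elt := rfl
  rw [this, h, h', sub_self]

/-- A chosen presentation of a finitely presented functor. -/
def pres (F : FP C) : Presentation F.obj := Classical.choice F.property

/-- The presentation `(X, -) ⟶ (X, -) ⟶ (X, -) ⟶ 0` of a representable functor, where the first
map is zero. -/
def presRepresentable (X : C) : Presentation (preadditiveCoyoneda.obj (op X)) where
  X := X
  Y := X
  f := 0
  π := 𝟙 _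
  exact A x := by
    constructor
    · intro hx
      exact ⟨0, (Limits.zero_comp : (0 : X ⟶ X) ≫ (0 : X ⟶ A) = 0).trans hx.symm⟩
    · rintro ⟨y, rfl⟩
      exact (Limits.zero_comp : (0 : X ⟶ X) ≫ (y : X ⟶ A) = 0)
  surj A x := ⟨x, rfl⟩

variable (C) in
/-- The contravariant Yoneda embedding `X ↦ (X, -)`, as a covariant functor to the opposite of the
category of finitely presented functors. -/
def yonedaFP : C ⥤ (FP C)ᵒᵖ :=
  (ObjectProperty.lift IsFP preadditiveCoyoneda
    (fun X ↦ ⟨presRepresentable X.unop⟩)).rightOp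

instance : (yonedaFP C).Additive where
  map_add {X Y f g} := by
    apply Quiver.Hom.unop_inj
    ext A x
    exact (Preadditive.add_comp _ _ _ f g (x : Y ⟶ A))

end FinitelyPresented

/-! ### Zeroth right derived functors of contravariant functors -/

section Derived

variable {C : Type u₁} [Category.{v₁} C] [Preadditive C]
  {D : Type u₂} [Category.{v₂} D] [Preadditive D] [HasKernels D]

section

variable (T : C ⥤ D) [T.Additive] {F F' F'' : C ⥤ AddCommGrpCat.{v₁}}

lemma ι_comp_map_eq {P : Presentation F} {P' : Presentation F'} {φ : F ⟶ F'}
    {a a' : P'.X ⟶ P.X} (h : P.IsLift P' φ a) (h' : P.IsLift P' φ a') :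
    kernel.ι (T.map P'.f) ≫ T.map a = kernel.ι (T.map P'.f) ≫ T.map a' := by
  obtain ⟨b, hb⟩ := h.ext h'
  rw [← sub_eq_zero, ← Preadditive.comp_sub, ← T.map_sub, ← hb, T.map_comp,
    kernel.condition_assoc, zero_comp]

/-- The morphism `ker (T X' ⟶ T Y') ⟶ ker (T X ⟶ T Y)` induced by `φ : F ⟶ F'` and presentations
`(Y, -) ⟶ (X, -) ⟶ F ⟶ 0` and `(Y', -) ⟶ (X', -) ⟶ F' ⟶ 0`. -/
def kernelMap (P : Presentation F) (P' : Presentation F') (φ : F ⟶ F') :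
    kernel (T.map P'.f) ⟶ kernel (T.map P.f) :=
  kernel.lift _ (kernel.ι _ ≫ T.map (P.exists_isLift P' φ).choose) (by
    obtain ⟨b, hb⟩ := (P.exists_isLift P' φ).choose_spec.exists_comm
    rw [Category.assoc, ← T.map_comp, ← hb, T.map_comp, kernel.condition_assoc, zero_comp])

lemma kernelMap_ι {P : Presentation F} {P' : Presentation F'} {φ : F ⟶ F'}
    {a : P'.X ⟶ P.X} (h : P.IsLift P' φ a) :
    kernelMap T P P' φ ≫ kernel.ι (T.map P.f) = kernel.ι (T.map P'.f) ≫ T.map a := by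
  rw [kernelMap, kernel.lift_ι]
  exact ι_comp_map_eq T (P.exists_isLift P' φ).choose_spec h

end

/-- For a covariant additive functor `T` on `C`, the contravariant functor on `fp(C, Ab)` sending
`F` with presentation `(Y, -) ⟶ (X, -) ⟶ F ⟶ 0` to the kernel of `T X ⟶ T Y`. -/
def kernelExtension (T : C ⥤ D) [T.Additive] : (FP C)ᵒᵖ ⥤ D where
  obj F := kernel (T.map (pres F.unop).f)
  map φ := kernelMap T (pres _) (pres _) φ.unop.hom
  map_id F := by
    rw [← cancel_mono (kernel.ι _), kernelMap_ι T (a := 𝟙 _)]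
    · simp
    · simp [Presentation.IsLift]
  map_comp {F G H} φ ψ := by
    obtain ⟨a, ha⟩ := (pres G.unop).exists_isLift (pres F.unop) φ.unop.hom
    obtain ⟨b, hb⟩ := (pres H.unop).exists_isLift (pres G.unop) ψ.unop.hom
    rw [← cancel_mono (kernel.ι _), Category.assoc, kernelMap_ι T hb,
      ← Category.assoc, kernelMap_ι T ha, kernelMap_ι T (a := a ≫ b)]
    · simp
    · have h := ConcreteCategory.congr_hom (φ.unop.hom.naturality b) (pres G.unop).elt
      unfold Presentation.IsLift at ha hb ⊢
      simp only [Functor.map_comp, unop_comp, ObjectProperty.FullSubcategory.comp_hom,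
        NatTrans.comp_app, ConcreteCategory.comp_apply] at h ⊢
      rw [ha, ← hb, h]

instance (T : C ⥤ D) [T.Additive] : (kernelExtension T).Additive where
  map_add {F G φ ψ} := by
    obtain ⟨a, ha⟩ := (pres G.unop).exists_isLift (pres F.unop) φ.unop.hom
    obtain ⟨b, hb⟩ := (pres G.unop).exists_isLift (pres F.unop) ψ.unop.hom
    have hab : (pres G.unop).IsLift (pres F.unop) (φ + ψ).unop.hom (a + b) := by
      unfold Presentation.IsLift at ha hb ⊢
      rw [Presentation.map_add_elt, ha, hb]
      rfl
    have key : kernelMap T (pres G.unop) (pres F.unop) (φ + ψ).unop.hom =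
        kernelMap T (pres G.unop) (pres F.unop) φ.unop.hom +
          kernelMap T (pres G.unop) (pres F.unop) ψ.unop.hom := by
      rw [← cancel_mono (kernel.ι _), Preadditive.add_comp, kernelMap_ι T ha, kernelMap_ι T hb,
        kernelMap_ι T hab, T.map_add, Preadditive.comp_add]
    exact key

/-- The zeroth right derived functor `R₀ S` of a contravariant additive functor `S` on
`fp(C, Ab)`, computed with projective presentations: if `(Y, -) ⟶ (X, -) ⟶ F ⟶ 0` is exact, then
`(R₀ S) F` is the kernel of `S (X, -) ⟶ S (Y, -)`. -/
def rightDerivedZero (S : (FP C)ᵒᵖ ⥤ D) [S.Additive] : (FP C)ᵒᵖ ⥤ D :=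
  kernelExtension (yonedaFP C ⋙ S)

end Derived

/-! ### Tensor products over a noncommutative ring

Right modules over `R` are modules over `Rᵐᵒᵖ`. -/

section Tensor

variable (R : Type u) [Ring R]

/-- The category `Mod(R)` of right `R`-modules. -/
abbrev RMod := ModuleCat.{u} Rᵐᵒᵖ

/-- Finite presentation of left `R`-modules, as a property of objects. -/
def isFinPres : ObjectProperty (ModuleCat.{u} R) := fun L ↦ Module.FinitePresentation R L

/-- The category `mod(Rᵒᵖ)` of finitely presented left `R`-modules. -/
abbrev FPLMod := (isFinPres R).FullSubcategory

variable {R}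

/-- The subgroup of `M ⊗[ℤ] L` generated by the elements `(m r) ⊗ l - m ⊗ (r l)`. -/
def balancing (M : ModuleCat.{u} Rᵐᵒᵖ) (L : ModuleCat.{u} R) : AddSubgroup (M ⊗[ℤ] L) :=
  AddSubgroup.closure
    {z | ∃ (m : M) (r : R) (l : L), z = (MulOpposite.op r • m) ⊗ₜ[ℤ] l - m ⊗ₜ[ℤ] (r • l)}

/-- The tensor product over `R` of a right module and a left module. -/
abbrev Tensor (M : ModuleCat.{u} Rᵐᵒᵖ) (L : ModuleCat.{u} R) : Type u :=
  (M ⊗[ℤ] L) ⧸ balancing M L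

/-- The homomorphism `f ⊗ g` between tensor products over `R`. -/
def Tensor.map {M M' : ModuleCat.{u} Rᵐᵒᵖ} {L L' : ModuleCat.{u} R} (f : M ⟶ M') (g : L ⟶ L') :
    Tensor M L →+ Tensor M' L' :=
  QuotientAddGroup.map _ _
    (TensorProduct.map f.hom.toAddMonoidHom.toIntLinearMap
      g.hom.toAddMonoidHom.toIntLinearMap).toAddMonoidHom (by
    rw [balancing, AddSubgroup.closure_le]
    rintro _ ⟨m, r, l, rfl⟩
    apply AddSubgroup.subset_closure
    refine ⟨f m, r, g l, ?_⟩
    simp [map_sub])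

lemma Tensor.ext {M : ModuleCat.{u} Rᵐᵒᵖ} {L : ModuleCat.{u} R} {A : Type*} [AddCommGroup A]
    {f g : Tensor M L →+ A}
    (h : ∀ (m : M) (l : L), f (QuotientAddGroup.mk (m ⊗ₜ[ℤ] l)) =
      g (QuotientAddGroup.mk (m ⊗ₜ[ℤ] l))) : f = g := by
  apply QuotientAddGroup.addMonoidHom_ext
  ext z
  induction z using TensorProduct.induction_on with
  | zero => simp
  | tmul m l => exact h m l
  | add x y hx hy => simp only [map_add, hx, hy]

@[simp]
lemma Tensor.map_mk {M M' : ModuleCat.{u} Rᵐᵒᵖ} {L L' : ModuleCat.{u} R} (f : M ⟶ M')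
    (g : L ⟶ L') (m : M) (l : L) :
    Tensor.map f g (QuotientAddGroup.mk (m ⊗ₜ[ℤ] l)) =
      QuotientAddGroup.mk ((f m) ⊗ₜ[ℤ] (g l)) := rfl

variable (R) in
/-- The category `(mod(Rᵒᵖ), Ab)` of additive functors. -/
abbrev LFun := FPLMod R ⥤+ AddCommGrpCat.{u}

/-- The functor `M ⊗ -` on finitely presented left modules. -/
def tensorObj (M : RMod R) : LFun R where
  obj :=
    { obj := fun L ↦ AddCommGrpCat.of (Tensor M L.obj)
      map := fun g ↦ AddCommGrpCat.ofHom (Tensor.map (𝟙 M) g.hom)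
      map_id := fun L ↦ by
        ext : 1
        exact Tensor.ext fun m l ↦ by simp
      map_comp := fun g h ↦ by
        ext : 1
        exact Tensor.ext fun m l ↦ by simp }
  property := ⟨fun {L L' g h} ↦ by
    ext : 1
    refine Tensor.ext fun m l ↦ ?_
    exact congrArg QuotientAddGroup.mk (TensorProduct.tmul_add m (g.hom l) (h.hom l))⟩

variable (R) in
/-- The tensor embedding `t : Mod(R) ⥤ (mod(Rᵒᵖ), Ab)`, `M ↦ M ⊗ -`. -/
def t : RMod R ⥤ LFun R where
  obj M := tensorObj M
  map f := ObjectProperty.homMk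
    { app := fun L ↦ AddCommGrpCat.ofHom (Tensor.map f (𝟙 L.obj))
      naturality := fun L L' g ↦ by
        ext : 1
        exact Tensor.ext fun m l ↦ rfl }
  map_id M := by
    ext L : 4
    exact Tensor.ext fun m l ↦ rfl
  map_comp f g := by
    ext L : 4
    exact Tensor.ext fun m l ↦ rfl

instance : (t R).Additive where
  map_add {M M' f g} := by
    ext L : 4
    refine Tensor.ext fun m l ↦ ?_
    exact congrArg QuotientAddGroup.mk (TensorProduct.add_tmul (f m) (g m) l)

end Tensor

/-! ### The functors -/

section Functors

instance additiveFunctor_isClosedUnderSubobjects (C : Type u₁) [Category.{v₁} C] [Preadditive C] :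
    (additiveFunctor C AddCommGrpCat.{u}).IsClosedUnderSubobjects where
  prop_of_mono {K F} i _ hF := ⟨fun {X Y f g} ↦ by
    have : F.Additive := hF
    rw [← cancel_mono (i.app Y), Preadditive.add_comp, i.naturality, i.naturality, i.naturality,
      F.map_add, Preadditive.comp_add]⟩

variable (R : Type u) [Ring R]

/-- The contravariant functor `w : fp(Mod(R), Ab) ⥤ Mod(R)`: a presentation
`(Y, -) ⟶ (X, -) ⟶ F ⟶ 0` gives an exact sequence `0 ⟶ w F ⟶ X ⟶ Y`. -/
def w : (FP (RMod R))ᵒᵖ ⥤ RMod R := kernelExtension (𝟭 (RMod R))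

instance : (w R).Additive := inferInstanceAs (kernelExtension (𝟭 (RMod R))).Additive

/-- The Auslander-Gruson-Jensen functor `D_A = R₀ (t ∘ w)`. -/
def DA : (FP (RMod R))ᵒᵖ ⥤ LFun R := rightDerivedZero (w R ⋙ t R)

instance : EssentiallySmall.{u} (FPLMod R) := by
  have h : isFinPres R ≤ ModuleCat.isFG R := fun L (_ : Module.FinitePresentation R L) ↦
    (inferInstance : Module.Finite R L)
  have : EssentiallySmall.{u} (FGModuleCat.{u} R) := inferInstance
  exact essentiallySmall_of_fully_faithful (ObjectProperty.ιOfLE h)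

/-- The group of natural transformations between two objects of `(mod(Rᵒᵖ), Ab)` is small. -/
instance (G H : LFun R) : Small.{u} (G ⟶ H) := by
  let e := equivSmallModel.{u} (FPLMod R)
  refine small_of_injective
    (β := (e.inverse ⋙ G.obj) ⟶ (e.inverse ⋙ H.obj)) (f := fun α ↦ e.inverse.whiskerLeft α.hom) ?_
  intro α β h
  ext : 1
  exact ((Functor.whiskeringLeft _ _ AddCommGrpCat.{u}).obj e.inverse).map_injective h

/-- The group `Nat(G, H)`, as an abelian group in the universe of `R`. -/
def natGrp (G H : LFun R) : AddCommGrpCat.{u} := AddCommGrpCat.of (Shrink.{u} (G ⟶ H))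

variable {R}

/-- The tautological identification of `natGrp R G H` with the group of natural transformations. -/
def natEquiv (G H : LFun R) : (G ⟶ H) ≃+ natGrp R G H :=
  (Shrink.addEquiv.{u} (α := G ⟶ H)).symm

/-- The homomorphism `Nat(G, H) ⟶ Nat(G', H')`, `θ ↦ α ≫ θ ≫ β`. -/
def natGrpMap {G G' H H' : LFun R} (α : G' ⟶ G) (β : H ⟶ H') : natGrp R G H ⟶ natGrp R G' H' :=
  AddCommGrpCat.ofHom
    ((natEquiv G' H').toAddMonoidHom.comp
      (((Preadditive.leftComp H' α).comp (Preadditive.rightComp G β)).comp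
        (natEquiv G H).symm.toAddMonoidHom))

lemma natGrpMap_apply {G G' H H' : LFun R} (α : G' ⟶ G) (β : H ⟶ H') (θ : G ⟶ H) :
    natGrpMap α β (natEquiv G H θ) = natEquiv G' H' (α ≫ θ ≫ β) := by
  change natEquiv G' H' (α ≫ (natEquiv G H).symm (natEquiv G H θ) ≫ β) = _
  rw [AddEquiv.symm_apply_apply]

lemma natGrp_ext {G H : LFun R} {A : AddCommGrpCat.{u}} {f g : natGrp R G H ⟶ A}
    (h : ∀ θ : G ⟶ H, f (natEquiv G H θ) = g (natEquiv G H θ)) : f = g := by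
  ext x
  obtain ⟨θ, rfl⟩ := (natEquiv G H).surjective x
  exact h θ

lemma natGrpMap_id (G H : LFun R) : natGrpMap (𝟙 G) (𝟙 H) = 𝟙 _ :=
  natGrp_ext fun θ ↦ by
    rw [natGrpMap_apply, Category.id_comp, Category.comp_id]
    rfl

lemma natGrpMap_comp {G G' G'' H H' H'' : LFun R} (α : G' ⟶ G) (α' : G'' ⟶ G') (β : H ⟶ H')
    (β' : H' ⟶ H'') :
    natGrpMap (α' ≫ α) (β ≫ β') = natGrpMap α β ≫ natGrpMap α' β' :=
  natGrp_ext fun θ ↦ by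
    rw [ConcreteCategory.comp_apply, natGrpMap_apply, natGrpMap_apply, natGrpMap_apply]
    simp only [Category.assoc]

variable (R)

/-- The contravariant functor `D_R`, given by `(D_R G)(M) = Nat(G, M ⊗ -)`, with values in all
functors `Mod(R) ⥤ Ab`. -/
def DR : (LFun R)ᵒᵖ ⥤ (RMod R ⥤ AddCommGrpCat.{u}) where
  obj G :=
    { obj := fun M ↦ natGrp R G.unop ((t R).obj M)
      map := fun f ↦ natGrpMap (𝟙 G.unop) ((t R).map f)
      map_id := fun M ↦ by rw [(t R).map_id, natGrpMap_id]
      map_comp := fun f g ↦ by rw [← natGrpMap_comp, (t R).map_comp, Category.id_comp] }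
  map φ :=
    { app := fun M ↦ natGrpMap φ.unop (𝟙 ((t R).obj M))
      naturality := fun M N f ↦ by simp only [← natGrpMap_comp, Category.id_comp, Category.comp_id] }
  map_id G := by
    ext M : 2
    exact natGrpMap_id _ _
  map_comp φ ψ := by
    ext M : 2
    dsimp
    rw [← natGrpMap_comp, Category.id_comp]

/-- The functor `D_R` with values in finitely presented functors, given that all `D_R G` are
finitely presented. -/
def DRfp (h : ∀ G : (LFun R)ᵒᵖ, IsFP ((DR R).obj G)) : (LFun R)ᵒᵖ ⥤ FP (RMod R) :=
  ObjectProperty.lift IsFP (DR R) h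

variable {R}

/-- A short exact sequence `0 ⟶ A ⟶ B ⟶ C ⟶ 0` of right modules is pure exact if
`0 ⟶ A ⊗ L ⟶ B ⊗ L ⟶ C ⊗ L ⟶ 0` is exact for every finitely presented left module `L`. -/
structure IsPureExact (S : ShortComplex (RMod R)) : Prop where
  shortExact : S.ShortExact
  injective : ∀ L : FPLMod R, Function.Injective (((t R).map S.f).hom.app L)
  exact : ∀ L : FPLMod R,
    Function.Exact (((t R).map S.f).hom.app L) (((t R).map S.g).hom.app L)
  surjective : ∀ L : FPLMod R, Function.Surjective (((t R).map S.g).hom.app L)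

/-- The functor `F` arises from a pure exact sequence `0 ⟶ X ⟶ Y ⟶ Z ⟶ 0`: there is an exact
sequence `0 ⟶ (Z, -) ⟶ (Y, -) ⟶ (X, -) ⟶ F ⟶ 0`. -/
def ArisesFromPureExact (F : RMod R ⥤ AddCommGrpCat.{u}) : Prop :=
  ∃ (S : ShortComplex (RMod R)) (_ : IsPureExact S)
    (π : preadditiveCoyoneda.obj (op S.X₁) ⟶ F), ∀ A : RMod R,
      Function.Injective ((preadditiveCoyoneda.map S.g.op).app A) ∧
      Function.Exact ((preadditiveCoyoneda.map S.g.op).app A)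
        ((preadditiveCoyoneda.map S.f.op).app A) ∧
      Function.Exact ((preadditiveCoyoneda.map S.f.op).app A) (π.app A) ∧
      Function.Surjective (π.app A)

/-- Exactness at every module of a sequence `0 ⟶ F₁ ⟶ F₂ ⟶ F₃ ⟶ F₄ ⟶ 0` of finitely presented
functors. -/
structure IsFourTermExact {F₁ F₂ F₃ F₄ : FP (RMod R)} (a : F₁ ⟶ F₂) (b : F₂ ⟶ F₃)
    (c : F₃ ⟶ F₄) : Prop where
  injective : ∀ A : RMod R, Function.Injective (a.hom.app A)
  exact₂ : ∀ A : RMod R, Function.Exact (a.hom.app A) (b.hom.app A)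
  exact₃ : ∀ A : RMod R, Function.Exact (b.hom.app A) (c.hom.app A)
  surjective : ∀ A : RMod R, Function.Surjective (c.hom.app A)

end Functors

end

end AGJ

/-! Everything is read off a presentation `f : X ⟶ Y` of `F`. A transformation from `F` to an
additive functor `H` is an element of `H X` killed by `H f` (`Presentation.homEquiv`). For `H = D_R
G` these are the transformations `G ⟶ X ⊗ -` that vanish after composition with `f ⊗ -`, hence the
transformations `G ⟶ ker (f ⊗ -)`. This kernel is `D_A F`, because `w` sends `(X, -)` back to `X`
(`DAIso`). That is the adjunction, and its unit sends the universal element of `F` to the inclusion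
of `D_A F` into `X ⊗ -` (`kernelAdjunction_unit_elt`).

Finitely presented functors are closed under kernels, cokernels and products. So `D_R G`, a kernel
of a map between products of functors `- ⊗ L`, is finitely presented (`isFP_DR`), and the four-term
sequence exists functorially. It remains to see that the relation map `X ⟶ Y` in a presentation of
`E = F_q` or `E = F^q` is a pure monomorphism: then `D_A E = 0`, and its cokernel completes it to
the required pure exact sequence.

Let `z` in `X ⊗ L` die in `Y ⊗ L`. For `E = F_q`, injectivity of `F_q ⟶ F` lifts `z` to an element
of `(D_A F) L` (`exists_tensor_lift`), and such elements go to zero in `X ⊗ L` because `F_q ⟶ F ⟶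
D_R D_A F` vanishes. For `E = F^q`, `z` is a transformation `F^q ⟶ - ⊗ L`, which gives a
transformation `D_R D_A F ⟶ - ⊗ L` killed by the unit. The crux is `exists_eq_eval`, proved with
character modules: every transformation `D_R G ⟶ - ⊗ L` is evaluation at an element of `G L`. Being
killed by the unit forces that element to be zero. -/

namespace AGJ

noncomputable section

/-! ### Presentations and closure properties of finitely presented functors. -/

section FinitelyPresented

variable {C : Type u₁} [Category.{v₁} C] {F F' H K Q : C ⥤ AddCommGrpCat.{v₁}}

lemma app_map_apply (φ : F ⟶ H) {A B : C} (a : A ⟶ B) (x : F.obj A) :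
    φ.app B (F.map a x) = H.map a (φ.app A x) :=
  ConcreteCategory.congr_hom (φ.naturality a) x

lemma map_comp_apply {A B D : C} (a : A ⟶ B) (b : B ⟶ D) (x : F.obj A) :
    F.map (a ≫ b) x = F.map b (F.map a x) := by
  rw [F.map_comp]
  rfl

variable [Preadditive C]

lemma map_sub_apply [F.Additive] {A B : C} (a b : A ⟶ B) (x : F.obj A) :
    F.map (a - b) x = F.map a x - F.map b x := by
  rw [F.map_sub]
  rfl

lemma map_add_apply [F.Additive] {A B : C} (a b : A ⟶ B) (x : F.obj A) :
    F.map (a + b) x = F.map a x + F.map b x := by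
  rw [F.map_add]
  rfl

lemma map_zero_apply [F.Additive] {A B : C} (x : F.obj A) :
    F.map (0 : A ⟶ B) x = 0 := by
  rw [F.map_zero]
  rfl

lemma additive_of_injective [F.Additive] (i : K ⟶ F)
    (hi : ∀ A, Function.Injective (i.app A)) : K.Additive where
  map_add {A B f g} := by
    ext x
    apply hi
    change i.app B (K.map (f + g) x) = i.app B (K.map f x + K.map g x)
    rw [map_add, app_map_apply, app_map_apply, app_map_apply, map_add_apply]

lemma additive_of_surjective [F.Additive] (p : F ⟶ Q)
    (hp : ∀ A, Function.Surjective (p.app A)) : Q.Additive where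
  map_add {A B f g} := by
    ext x
    obtain ⟨y, rfl⟩ := hp A x
    change Q.map (f + g) (p.app A y) = Q.map f (p.app A y) + Q.map g (p.app A y)
    rw [← app_map_apply, ← app_map_apply, ← app_map_apply, map_add_apply, map_add]

/-- The transformation `(X, -) ⟶ F` determined by an element of `F X`. -/
def ofElt [F.Additive] {X : C} (e : F.obj X) : preadditiveCoyoneda.obj (op X) ⟶ F where
  app A := AddCommGrpCat.ofHom
    { toFun := fun a : X ⟶ A ↦ F.map a e
      map_zero' := map_zero_apply e
      map_add' := fun a b ↦ map_add_apply a b e }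
  naturality A B a := by
    ext b
    exact map_comp_apply (F := F) b a e

/-- By Yoneda a presentation is a generating element with its relations; the closure properties
below are all proved by exhibiting these. -/
lemma IsFP.of_elt [F.Additive] {X Y : C} (f : X ⟶ Y) (e : F.obj X)
    (surj : ∀ (A : C) (x : F.obj A), ∃ a : X ⟶ A, F.map a e = x)
    (zero : F.map f e = 0)
    (exact : ∀ (A : C) (a : X ⟶ A), F.map a e = 0 → ∃ b : Y ⟶ A, f ≫ b = a) : IsFP F :=
  ⟨{ X := X
     Y := Y
     f := f
     π := ofElt e
     exact := fun A a ↦ ⟨exact A a, by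
      rintro ⟨b, rfl⟩
      exact (map_comp_apply f b e).trans (by rw [zero, map_zero])⟩
     surj := surj }⟩

lemma Presentation.hom_ext (P : Presentation F) {φ ψ : F ⟶ H}
    (h : φ.app P.X P.elt = ψ.app P.X P.elt) : φ = ψ := by
  ext A x
  obtain ⟨a, rfl⟩ := P.exists_map_elt x
  rw [app_map_apply, app_map_apply, h]

lemma Presentation.map_elt_eq_iff (P : Presentation F) {A : C} (a b : P.X ⟶ A) :
    F.map a P.elt = F.map b P.elt ↔ ∃ c : P.Y ⟶ A, a = b + P.f ≫ c := by
  have := IsFP.additive ⟨P⟩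
  constructor
  · intro h
    obtain ⟨c, hc⟩ := P.exists_of_map_elt_eq_zero (a - b) (by rw [map_sub_apply, h, sub_self])
    exact ⟨c, by rw [hc]; abel⟩
  · rintro ⟨c, rfl⟩
    rw [map_add_apply, map_comp_apply, P.map_f_elt, map_zero, add_zero]

lemma Presentation.exists_hom [H.Additive] (P : Presentation F) (x : H.obj P.X)
    (hx : H.map P.f x = 0) : ∃ φ : F ⟶ H, φ.app P.X P.elt = x := by
  -- The value at `y = F.map a P.elt` has to be `H.map a x`. It does not depend on `a`: two choices
  -- differ by a morphism through `P.f`, which kills `x`.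
  have key {A : C} (a : P.X ⟶ A) (y : F.obj A) (h : F.map a P.elt = y) :
      H.map (P.exists_map_elt y).choose x = H.map a x := by
    obtain ⟨c, hc⟩ := (P.map_elt_eq_iff _ a).1 ((P.exists_map_elt y).choose_spec.trans h.symm)
    rw [hc, map_add_apply, map_comp_apply, hx, map_zero, add_zero]
  have := IsFP.additive ⟨P⟩
  refine ⟨{
    app := fun A ↦ AddCommGrpCat.ofHom
      { toFun := fun y ↦ H.map (P.exists_map_elt y).choose x
        map_zero' := by rw [key 0 0 (map_zero_apply _), map_zero_apply]
        map_add' := fun y z ↦ by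
          rw [key ((P.exists_map_elt y).choose + (P.exists_map_elt z).choose) (y + z),
            map_add_apply]
          rw [map_add_apply, (P.exists_map_elt y).choose_spec, (P.exists_map_elt z).choose_spec] }
    naturality := fun A B a ↦ ?_ }, ?_⟩
  · ext y
    refine (key ((P.exists_map_elt y).choose ≫ a) _ ?_).trans (map_comp_apply _ a x)
    rw [map_comp_apply, (P.exists_map_elt y).choose_spec]
    rfl
  · refine (key (𝟙 _) P.elt ?_).trans ?_ <;> simp

/-- Transformations out of a presented functor correspond to elements killed by the relations. -/
def Presentation.homEquiv [H.Additive] (P : Presentation F) :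
    {x : H.obj P.X // H.map P.f x = 0} ≃ (F ⟶ H) where
  toFun x := (P.exists_hom x.1 x.2).choose
  invFun φ := ⟨φ.app P.X P.elt, by rw [← app_map_apply, P.map_f_elt, map_zero]⟩
  left_inv x := Subtype.ext (P.exists_hom x.1 x.2).choose_spec
  right_inv φ := P.hom_ext (P.exists_hom (φ.app P.X P.elt)
    (by rw [← app_map_apply, P.map_f_elt, map_zero])).choose_spec

lemma Presentation.homEquiv_elt [H.Additive] (P : Presentation F)
    (x : {x : H.obj P.X // H.map P.f x = 0}) : ((homEquiv P) x).app P.X P.elt = x.1 :=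
  (P.exists_hom x.1 x.2).choose_spec

/-- An element `F.map u P.elt` dies in `F'` exactly when `a ≫ u` factors through `P'.f`, that is,
when `u` extends to the pushout of `a` and `P'.f`. This pushout carries the generator of `K`. A
morphism out of it gives zero when its restriction to `P.X` factors through `P.f`, so a second
pushout carries the relations. -/
lemma IsFP.of_kernel [HasPushouts C] (i : K ⟶ F) (φ : F ⟶ F')
    (hi : ∀ A, Function.Injective (i.app A)) (h : ∀ A, Function.Exact (i.app A) (φ.app A))
    (hF : IsFP F) (hF' : IsFP F') : IsFP K := by
  have := hF.additive
  have := hF'.additive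
  have := additive_of_injective i hi
  obtain ⟨P⟩ := hF
  obtain ⟨P'⟩ := hF'
  obtain ⟨a, ha⟩ := P.exists_isLift P' φ
  have zero {A : C} (u : P.X ⟶ A) :
      φ.app A (F.map u P.elt) = 0 ↔ ∃ v : P'.Y ⟶ A, a ≫ u = P'.f ≫ v := by
    rw [app_map_apply, ← ha, ← map_comp_apply]
    constructor
    · intro h
      obtain ⟨v, hv⟩ := P'.exists_of_map_elt_eq_zero _ h
      exact ⟨v, hv.symm⟩
    · rintro ⟨v, hv⟩
      rw [hv, map_comp_apply, P'.map_f_elt, map_zero]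
  obtain ⟨e, he⟩ := (h _ _).1 ((zero (pushout.inl a P'.f)).2 ⟨_, pushout.condition⟩)
  refine IsFP.of_elt (pushout.inl (pushout.inl a P'.f) P.f) e ?_ ?_ ?_
  · intro A x
    obtain ⟨u, hu⟩ := P.exists_map_elt (i.app A x)
    obtain ⟨v, hv⟩ := (zero u).1 (by rw [hu]; exact (h _ _).2 ⟨x, rfl⟩)
    refine ⟨pushout.desc u v hv, hi _ ?_⟩
    rw [app_map_apply, he, ← map_comp_apply, pushout.inl_desc, hu]
  · apply hi
    rw [app_map_apply, he, ← map_comp_apply, pushout.condition, map_comp_apply, P.map_f_elt,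
      map_zero, map_zero]
  · intro A b hb
    obtain ⟨c, hc⟩ := P.exists_of_map_elt_eq_zero (pushout.inl a P'.f ≫ b) (by
      rw [map_comp_apply, ← he, ← app_map_apply, hb, map_zero])
    exact ⟨pushout.desc b c hc.symm, pushout.inl_desc _ _ _⟩

/-- The generator of `F'` generates `Q`; its relations are those of `F'` together with the image of
the generator of `F`. -/
lemma IsFP.of_cokernel [HasBinaryBiproducts C] (φ : F ⟶ F') (p : F' ⟶ Q)
    (h : ∀ A, Function.Exact (φ.app A) (p.app A)) (hp : ∀ A, Function.Surjective (p.app A))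
    (hF : IsFP F) (hF' : IsFP F') : IsFP Q := by
  have := hF'.additive
  have := additive_of_surjective p hp
  obtain ⟨P⟩ := hF
  obtain ⟨P'⟩ := hF'
  obtain ⟨a, ha⟩ := P.exists_isLift P' φ
  refine IsFP.of_elt (biprod.lift P'.f a) (p.app _ P'.elt) ?_ ?_ ?_
  · intro A x
    obtain ⟨y, rfl⟩ := hp A x
    obtain ⟨u, rfl⟩ := P'.exists_map_elt y
    exact ⟨u, (app_map_apply _ _ _).symm⟩
  · rw [← app_map_apply, biprod.lift_eq, map_add_apply, map_comp_apply, P'.map_f_elt, map_zero,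
      zero_add, map_comp_apply, ha, ← app_map_apply]
    exact (h _ _).2 ⟨_, rfl⟩
  · intro A u hu
    rw [← app_map_apply] at hu
    obtain ⟨x, hx⟩ := (h _ _).1 hu
    obtain ⟨v, rfl⟩ := P.exists_map_elt x
    rw [app_map_apply, ← ha, ← map_comp_apply] at hx
    obtain ⟨c, hc⟩ := (P'.map_elt_eq_iff _ _).1 hx.symm
    exact ⟨biprod.desc c v, by rw [biprod.lift_desc, hc, add_comm]⟩

variable {I : Type v₁}

/-- The objectwise product of functors. -/
def piFunctor (F : I → C ⥤ AddCommGrpCat.{v₁}) : C ⥤ AddCommGrpCat.{v₁} where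
  obj A := AddCommGrpCat.of (∀ i, (F i).obj A)
  map f := AddCommGrpCat.ofHom (AddMonoidHom.piMap fun i ↦ ((F i).map f).hom)
  map_id A := by
    ext x i
    exact ConcreteCategory.congr_hom ((F i).map_id A) (x i)
  map_comp f g := by
    ext x i
    exact ConcreteCategory.congr_hom ((F i).map_comp f g) (x i)

/-- Coproducts of generators and of relations present the product, as `(∐ X i, -)` is the product of
the `(X i, -)` and products of abelian groups are exact. -/
lemma IsFP.piFunctor [HasColimitsOfShape (Discrete I) C] {F : I → C ⥤ AddCommGrpCat.{v₁}}
    (hF : ∀ i, IsFP (F i)) : IsFP (piFunctor F) := by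
  have (i : I) := (hF i).additive
  have : (AGJ.piFunctor F).Additive := ⟨fun {A B f g} ↦ by
    ext x
    exact funext fun i ↦ map_add_apply (F := F i) f g (x i)⟩
  let P (i : I) : Presentation (F i) := (hF i).some
  refine IsFP.of_elt (F := AGJ.piFunctor F) (Limits.Sigma.map fun i ↦ (P i).f)
    (show ∀ i, (F i).obj (∐ fun i ↦ (P i).X) from
      fun i ↦ (F i).map (Sigma.ι (fun i ↦ (P i).X) i) (P i).elt) ?_ ?_ ?_
  · intro A x
    choose a ha using fun i ↦ (P i).exists_map_elt (x i)
    refine ⟨Sigma.desc a, funext fun i ↦ ?_⟩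
    refine (map_comp_apply (F := F i) _ _ _).symm.trans ?_
    rw [Sigma.ι_desc, ha]
  · funext i
    refine (map_comp_apply (F := F i) _ _ _).symm.trans ?_
    rw [Sigma.ι_map, map_comp_apply, (P i).map_f_elt, map_zero]
    rfl
  · intro A a ha
    have (i : I) : ∃ b, (P i).f ≫ b = Sigma.ι (fun i ↦ (P i).X) i ≫ a := by
      apply (P i).exists_of_map_elt_eq_zero
      rw [map_comp_apply]
      exact congrFun ha i
    choose b hb using this
    refine ⟨Sigma.desc b, Sigma.hom_ext _ _ fun i ↦ ?_⟩
    rw [Sigma.ι_map_assoc, Sigma.ι_desc, hb]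

end FinitelyPresented

/-! ### Tensor products over a noncommutative ring. -/

section Tensor

variable {R : Type u} [Ring R]

lemma linearMap_apply_eq_sum {n : ℕ} {N : Type*} [AddCommGroup N] [Module R N]
    (f : (Fin n → R) →ₗ[R] N) (s : Fin n → R) : f s = ∑ i, s i • f (Pi.single i 1) := by
  conv_lhs => rw [← Finset.univ_sum_single s, map_sum]
  refine Finset.sum_congr rfl fun i _ ↦ ?_
  rw [← map_smul, ← Pi.single_smul, smul_eq_mul, mul_one]

namespace Tensor

variable {M M' : ModuleCat.{u} Rᵐᵒᵖ} {L L' : ModuleCat.{u} R} {A : Type*} [AddCommGroup A]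

variable (M L) in
/-- The biadditive map `(m, l) ↦ m ⊗ l`. -/
def tmul : M →+ L →+ Tensor M L where
  toFun m :=
    { toFun := fun l ↦ QuotientAddGroup.mk (m ⊗ₜ[ℤ] l)
      map_zero' := by rw [TensorProduct.tmul_zero]; rfl
      map_add' := fun l l' ↦ congrArg QuotientAddGroup.mk (TensorProduct.tmul_add m l l') }
  map_zero' := by
    ext l
    exact congrArg QuotientAddGroup.mk (TensorProduct.zero_tmul M l)
  map_add' m m' := by
    ext l
    exact congrArg QuotientAddGroup.mk (TensorProduct.add_tmul m m' l)

lemma smul_tmul (r : R) (m : M) (l : L) :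
    tmul M L (MulOpposite.op r • m) l = tmul M L m (r • l) := by
  refine QuotientAddGroup.eq_iff_sub_mem.2 (AddSubgroup.subset_closure ⟨m, r, l, rfl⟩)

lemma map_tmul (f : M ⟶ M') (g : L ⟶ L') (m : M) (l : L) :
    Tensor.map f g (tmul M L m l) = tmul M' L' (f m) (g l) := rfl

lemma induction_on {p : Tensor M L → Prop} (z : Tensor M L) (zero : p 0)
    (tmul : ∀ m l, p (tmul M L m l)) (add : ∀ x y, p x → p y → p (x + y)) : p z := by
  obtain ⟨z, rfl⟩ := QuotientAddGroup.mk_surjective z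
  induction z using TensorProduct.induction_on with
  | zero => exact zero
  | tmul m l => exact tmul m l
  | add x y hx hy => exact add _ _ hx hy

/-- A balanced biadditive map induces a homomorphism on the tensor product. -/
def lift (φ : M →+ L →+ A) (h : ∀ (r : R) m l, φ (MulOpposite.op r • m) l = φ m (r • l)) :
    Tensor M L →+ A :=
  QuotientAddGroup.lift _
    (TensorProduct.liftAddHom φ fun n m l ↦ by simp [map_zsmul]) (by
      rw [balancing, AddSubgroup.closure_le]
      rintro _ ⟨m, r, l, rfl⟩
      simp [h])

lemma map_surjective {f : M ⟶ M'} (hf : Function.Surjective f) :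
    Function.Surjective (Tensor.map f (𝟙 L)) := by
  intro z
  induction z using Tensor.induction_on with
  | zero => exact ⟨0, map_zero _⟩
  | tmul m l =>
    obtain ⟨m, rfl⟩ := hf m
    exact ⟨tmul M L m l, rfl⟩
  | add x y hx hy =>
    obtain ⟨x, rfl⟩ := hx
    obtain ⟨y, rfl⟩ := hy
    exact ⟨x + y, map_add _ _ _⟩

/-- Balancing relations lift along a surjection; this passes right exactness from `⊗[ℤ]` to the
quotient in `map_exact`. -/
lemma balancing_le_map {g : M ⟶ M'} (hg : Function.Surjective g) :
    balancing M' L ≤ (balancing M L).map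
      (g.hom.toAddMonoidHom.toIntLinearMap.rTensor L).toAddMonoidHom := by
  rw [balancing, AddSubgroup.closure_le]
  rintro _ ⟨m, r, l, rfl⟩
  obtain ⟨m, rfl⟩ := hg m
  refine ⟨(MulOpposite.op r • m) ⊗ₜ[ℤ] l - m ⊗ₜ[ℤ] (r • l),
    AddSubgroup.subset_closure ⟨m, r, l, rfl⟩, ?_⟩
  simp

lemma map_exact {M'' : ModuleCat.{u} Rᵐᵒᵖ} {f : M ⟶ M'} {g : M' ⟶ M''}
    (h : Function.Exact f g) (hg : Function.Surjective g) :
    Function.Exact (Tensor.map f (𝟙 L)) (Tensor.map g (𝟙 L)) := by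
  intro z
  constructor
  · obtain ⟨z, rfl⟩ := QuotientAddGroup.mk_surjective z
    intro hz
    obtain ⟨b, hb, hbz⟩ := balancing_le_map hg ((QuotientAddGroup.eq_zero_iff _).1 hz)
    have h' : Function.Exact f.hom.toAddMonoidHom.toIntLinearMap
      g.hom.toAddMonoidHom.toIntLinearMap := h
    obtain ⟨x, hx⟩ := (rTensor_exact L h' hg (z - b)).1 ((map_sub _ _ _).trans
      (sub_eq_zero.2 hbz.symm))
    refine ⟨QuotientAddGroup.mk x, ?_⟩
    refine QuotientAddGroup.eq_iff_sub_mem.2 ?_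
    change LinearMap.rTensor L _ x - z ∈ _
    rw [hx, sub_sub_cancel_left]
    exact neg_mem hb
  · rintro ⟨x, rfl⟩
    induction x using Tensor.induction_on with
    | zero => simp
    | tmul m l => rw [map_tmul, map_tmul, (h _).2 ⟨m, rfl⟩, map_zero]; rfl
    | add x y hx hy => rw [map_add, map_add, hx, hy, add_zero]

/-- Elements of `M ⊗ L` in terms of generators of `L`. -/
lemma exists_eq_sum {n : ℕ} {f : (Fin n → R) →ₗ[R] L} (hf : Function.Surjective f)
    (z : Tensor M L) : ∃ x : Fin n → M, z = ∑ i, tmul M L (x i) (f (Pi.single i 1)) := by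
  induction z using Tensor.induction_on with
  | zero => exact ⟨0, by simp⟩
  | tmul m l =>
    obtain ⟨s, rfl⟩ := hf l
    refine ⟨fun i ↦ MulOpposite.op (s i) • m, ?_⟩
    simp only [smul_tmul]
    rw [← map_sum, linearMap_apply_eq_sum f s]
  | add x y hx hy =>
    obtain ⟨x, rfl⟩ := hx
    obtain ⟨y, rfl⟩ := hy
    exact ⟨x + y, by simp [Finset.sum_add_distrib]⟩

/-- The equational criterion for the vanishing of an element of `M ⊗ L`. -/
lemma sum_eq_zero_iff {n m : ℕ} {f : (Fin n → R) →ₗ[R] L} (hf : Function.Surjective f)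
    {g : (Fin m → R) →ₗ[R] (Fin n → R)} (h : Function.Exact g f) (x : Fin n → M) :
    ∑ i, tmul M L (x i) (f (Pi.single i 1)) = 0 ↔
      ∃ y : Fin m → M, x = fun i ↦ ∑ j, MulOpposite.op (g (Pi.single j 1) i) • y j := by
  have g_apply (c : Fin m → R) (i : Fin n) : g c i = ∑ j, c j * g (Pi.single j 1) i := by
    rw [linearMap_apply_eq_sum g c]
    simp only [Finset.sum_apply, Pi.smul_apply, smul_eq_mul]
  constructor
  · intro hx
    -- The map `ρ` is `M^m ⟶ M^n`, obtained by tensoring `g` with `M`. Sending `(m, l)` to the class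
    -- of `(m s_i)`, for any `s` with `f s = l`, is balanced and well defined modulo the image of
    -- `ρ`. The resulting `Φ` takes the given sum to the class of `x`.
    let ρ : (Fin m → M) →+ (Fin n → M) :=
      { toFun := fun y i ↦ ∑ j, MulOpposite.op (g (Pi.single j 1) i) • y j
        map_zero' := by ext; simp
        map_add' := fun y z ↦ by ext; simp [Finset.sum_add_distrib] }
    let Q := (Fin n → M) ⧸ ρ.range
    let q (s : Fin n → R) (m : M) : Q := QuotientAddGroup.mk fun i ↦ MulOpposite.op (s i) • m
    have q_add (s s' : Fin n → R) (m : M) : q (s + s') m = q s m + q s' m := by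
      refine congrArg QuotientAddGroup.mk (funext fun i ↦ ?_)
      simp [add_smul]
    have q_add' (s : Fin n → R) (m m' : M) : q s (m + m') = q s m + q s m' := by
      refine congrArg QuotientAddGroup.mk (funext fun i ↦ ?_)
      simp
    have q_ker (s : Fin n → R) (m : M) (hs : f s = 0) : q s m = 0 := by
      obtain ⟨c, rfl⟩ := (h s).1 hs
      refine (QuotientAddGroup.eq_zero_iff _).2 ⟨fun j ↦ MulOpposite.op (c j) • m, funext fun i ↦ ?_⟩
      change ∑ j, MulOpposite.op (g (Pi.single j 1) i) • MulOpposite.op (c j) • m = _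
      rw [g_apply c i, Finset.op_sum, Finset.sum_smul]
      simp [mul_smul]
    have q_eq (s s' : Fin n → R) (m : M) (hs : f s = f s') : q s m = q s' m := by
      rw [← sub_add_cancel s s', q_add, q_ker _ _ (by rw [map_sub, hs, sub_self]), zero_add]
    choose σ hσ using hf
    let Φ : Tensor M L →+ Q := lift
      (AddMonoidHom.mk' (fun m ↦ AddMonoidHom.mk' (fun l ↦ q (σ l) m) fun l l' ↦ by
          rw [← q_add]
          exact q_eq _ _ _ (by simp [hσ]))
        fun m m' ↦ by ext l; exact q_add' _ _ _)
      fun r m l ↦ by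
        refine Eq.trans ?_ (q_eq (r • σ l) _ _ (by simp [hσ]))
        refine congrArg QuotientAddGroup.mk (funext fun i ↦ ?_)
        simp [mul_smul]
    have hΦ (i : Fin n) (m : M) : Φ (tmul M L m (f (Pi.single i 1))) =
        QuotientAddGroup.mk (Pi.single i m) := by
      refine (q_eq (σ (f (Pi.single i 1))) (Pi.single i 1) m (hσ _)).trans ?_
      refine congrArg QuotientAddGroup.mk (funext fun j ↦ ?_)
      by_cases hij : j = i
      · subst hij; simp
      · simp [hij]
    have hx' := congrArg Φ hx
    rw [map_sum, map_zero, Finset.sum_congr rfl fun i _ ↦ hΦ i (x i)] at hx'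
    have hx'' : (QuotientAddGroup.mk x : Q) = 0 := by
      rw [← hx', ← Finset.univ_sum_single x]
      exact (map_sum (QuotientAddGroup.mk' ρ.range) _ _).trans (by simp)
    obtain ⟨y, hy⟩ := (QuotientAddGroup.eq_zero_iff _).1 hx''
    exact ⟨y, hy.symm⟩
  · rintro ⟨y, rfl⟩
    simp only [map_sum, AddMonoidHom.finsetSum_apply, smul_tmul]
    rw [Finset.sum_comm]
    refine Finset.sum_eq_zero fun j _ ↦ ?_
    rw [← map_sum, ← map_zero (tmul M L (y j)), ← (h (g (Pi.single j 1))).2 ⟨_, rfl⟩]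
    rw [linearMap_apply_eq_sum f (g (Pi.single j 1))]

end Tensor

/-- The functor `- ⊗ L` on right modules. -/
def tensorRight (L : FPLMod R) : RMod R ⥤ AddCommGrpCat.{u} where
  obj M := AddCommGrpCat.of (Tensor M L.obj)
  map f := AddCommGrpCat.ofHom (Tensor.map f (𝟙 L.obj))
  map_id M := by
    ext : 1
    exact Tensor.ext fun m l ↦ rfl
  map_comp f g := by
    ext : 1
    exact Tensor.ext fun m l ↦ rfl

instance (L : FPLMod R) : (tensorRight L).Additive where
  map_add {M M' f g} := by
    ext : 1
    exact Tensor.ext fun m l ↦ congrArg QuotientAddGroup.mk (TensorProduct.add_tmul (f m) (g m) l)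

/-- A presentation `R^m ⟶ R^n ⟶ L` has a transpose `φ` between free right modules. An element of `A
⊗ L` is a tuple in `A^n`, that is, a morphism out of the free module of rank `n`. By the equational
criterion it vanishes exactly when this morphism factors through `φ`. -/
lemma isFP_tensorRight (L : FPLMod R) : IsFP (tensorRight L) := by
  obtain ⟨n, m, f, g, hf, h⟩ := @Module.FinitePresentation.exists_fin' R L.obj _ _ _ L.property
  let b (k : ℕ) := Pi.basisFun Rᵐᵒᵖ (Fin k)
  let X (k : ℕ) : RMod R := ModuleCat.of Rᵐᵒᵖ (Fin k → Rᵐᵒᵖ)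
  let φ : X n ⟶ X m :=
    ModuleCat.ofHom ((b n).constr ℕ fun i j ↦ MulOpposite.op (g (Pi.single j 1) i))
  let e : Tensor (X n) L.obj :=
    ∑ i, Tensor.tmul (X n) L.obj (b n i) (f (Pi.single i 1))
  have he {A : RMod R} (a : X n ⟶ A) : Tensor.map a (𝟙 L.obj) e =
      ∑ i, Tensor.tmul A L.obj (a (b n i)) (f (Pi.single i 1)) := by
    rw [map_sum]
    rfl
  refine IsFP.of_elt (F := tensorRight L) φ e ?_ ?_ ?_
  · intro A z
    obtain ⟨x, rfl⟩ := Tensor.exists_eq_sum hf z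
    refine ⟨ModuleCat.ofHom ((b n).constr ℕ x), (he _).trans ?_⟩
    refine Finset.sum_congr rfl fun i _ ↦ ?_
    exact congrArg (fun y ↦ Tensor.tmul A L.obj y _) ((b n).constr_basis ℕ x i)
  · refine (he φ).trans ((Tensor.sum_eq_zero_iff hf h _).2 ⟨b m, funext fun i ↦ ?_⟩)
    refine ((b n).constr_basis ℕ _ i).trans ?_
    exact ((b m).sum_repr fun j ↦ MulOpposite.op (g (Pi.single j 1) i)).symm
  · intro A a ha
    obtain ⟨y, hy⟩ := (Tensor.sum_eq_zero_iff hf h _).1 ((he a).symm.trans ha)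
    refine ⟨ModuleCat.ofHom ((b m).constr ℕ y), ?_⟩
    ext : 1
    refine (b n).ext fun i ↦ ?_
    refine Eq.trans ?_ (congrFun hy i).symm
    change (b m).constr ℕ y ((b n).constr ℕ _ (b n i)) = _
    rw [Module.Basis.constr_basis, Module.Basis.constr_apply_fintype]
    simp [b]

/-! ### Character modules -/

/-- The character descends to the range of `ρ` and extends to `B`, since `ℚ/ℤ` is injective. -/
lemma exists_character_comp_eq {A B : Type*} [AddCommGroup A] [AddCommGroup B] (ρ : A →+ B)
    (χ : CharacterModule A) (h : ∀ a, ρ a = 0 → χ a = 0) :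
    ∃ ψ : CharacterModule B, ∀ a, ψ (ρ a) = χ a := by
  let ρ' := ρ.toIntLinearMap
  let χ' : (A ⧸ ρ'.ker) →ₗ[ℤ] AddCircle (1 : ℚ) :=
    ρ'.ker.liftQ (AddMonoidHom.toIntLinearMap χ) fun a ha ↦ h a ha
  obtain ⟨ψ, hψ⟩ := CharacterModule.dual_surjective_of_injective ρ'.range.subtype
    Subtype.val_injective (χ'.comp ρ'.quotKerEquivRange.symm.toLinearMap).toAddMonoidHom
  refine ⟨ψ, fun a ↦ ?_⟩
  have := DFunLike.congr_fun hψ ⟨ρ a, a, rfl⟩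
  refine this.trans ?_
  exact congrArg χ' (ρ'.quotKerEquivRange_symm_apply_image a ⟨a, rfl⟩)

/-- The underlying group of the character module of a left module. -/
def DualType (L : ModuleCat.{u} R) : Type u := L →+ AddCircle (1 : ℚ)

namespace DualType

variable {L : ModuleCat.{u} R}

instance : AddCommGroup (DualType L) := inferInstanceAs (AddCommGroup (L →+ AddCircle (1 : ℚ)))

/-- The value of a character. -/
def eval (χ : DualType L) : L →+ AddCircle (1 : ℚ) := χ

instance : Module Rᵐᵒᵖ (DualType L) where
  smul r χ := χ.eval.comp (DistribSMul.toAddMonoidHom L r.unop)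
  one_smul χ := AddMonoidHom.ext fun l ↦ congrArg χ.eval (one_smul R l)
  mul_smul r s χ := AddMonoidHom.ext fun l ↦ congrArg χ.eval (mul_smul s.unop r.unop l)
  smul_zero _ := rfl
  smul_add _ _ _ := rfl
  add_smul r s χ := AddMonoidHom.ext fun l ↦
    (congrArg χ.eval (add_smul r.unop s.unop l)).trans (map_add χ.eval _ _)
  zero_smul χ := AddMonoidHom.ext fun l ↦
    (congrArg χ.eval (zero_smul R l)).trans (map_zero χ.eval)

lemma eval_sum {ι : Type*} (s : Finset ι) (χ : ι → DualType L) (l : L) :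
    (∑ i ∈ s, χ i).eval l = ∑ i ∈ s, (χ i).eval l :=
  AddMonoidHom.finsetSum_apply (M := L) (N := AddCircle (1 : ℚ)) χ s l

lemma ext {χ χ' : DualType L} (h : ∀ l, χ.eval l = χ'.eval l) : χ = χ' :=
  AddMonoidHom.ext h

end DualType

/-- The character module of a left module, as a right module. -/
def rightDual (L : ModuleCat.{u} R) : RMod R := ModuleCat.of Rᵐᵒᵖ (DualType L)

/-- The pairing of the character module of `L` with `L'` induced by `h : L' ⟶ L`. -/
def pairing {L L' : ModuleCat.{u} R} (h : L' ⟶ L) :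
    Tensor (rightDual L) L' →+ AddCircle (1 : ℚ) :=
  Tensor.lift
    (AddMonoidHom.mk' (fun χ : DualType L ↦ χ.eval.comp h.hom.toAddMonoidHom) fun _ _ ↦ rfl)
    fun r χ l ↦ congrArg (DualType.eval χ) (map_smul h.hom r l).symm

lemma pairing_tmul {L L' : ModuleCat.{u} R} (h : L' ⟶ L) (χ : DualType L) (l : L') :
    pairing h (Tensor.tmul (rightDual L) L' χ l) = χ.eval (h l) := rfl

/-- This is injectivity of the canonical map from `L* ⊗ L'` to the dual of `Hom(L', L)`. The kernel
of `ρ : L^n ⟶ L^m` is `Hom(L', L)`, so the hypothesis makes the character of `L^n` with components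
`χ i` factor through `ρ`. The components of the extension to `L^m` solve the equations of
`Tensor.sum_eq_zero_iff`. -/
lemma eq_zero_of_pairing_eq_zero {L L' : ModuleCat.{u} R} [Module.FinitePresentation R L']
    (z : Tensor (rightDual L) L') (hz : ∀ h : L' ⟶ L, pairing h z = 0) : z = 0 := by
  obtain ⟨n, m, f, g, hf, hgf⟩ := Module.FinitePresentation.exists_fin' R L'
  obtain ⟨x, rfl⟩ := Tensor.exists_eq_sum hf z
  let χ (i : Fin n) : DualType L := x i
  let ρ : (Fin n → L) →+ (Fin m → L) :=
    { toFun := fun l j ↦ ∑ i, g (Pi.single j 1) i • l i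
      map_zero' := by ext; simp
      map_add' := fun y z ↦ by ext; simp [Finset.sum_add_distrib] }
  let χ' : (Fin n → L) →+ AddCircle (1 : ℚ) :=
    ∑ i, (χ i).eval.comp (Pi.evalAddMonoidHom _ i)
  have hχ' (l : Fin n → L) : χ' l = ∑ i, (χ i).eval (l i) :=
    AddMonoidHom.finsetSum_apply _ _ _
  obtain ⟨ψ, hψ⟩ := exists_character_comp_eq ρ χ' fun l hl ↦ by
    -- A tuple `l` killed by `ρ` satisfies the relations of `L'`, so it defines a morphism `h : L' ⟶
    -- L` to which `hz` applies.
    let k : (Fin n → R) →ₗ[R] L := (Pi.basisFun R (Fin n)).constr ℕ l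
    have hk (i : Fin n) : k (Pi.single i 1) = l i := by
      rw [← Pi.basisFun_apply]
      exact (Pi.basisFun R (Fin n)).constr_basis ℕ l i
    have hkg (j : Fin m) : k (g (Pi.single j 1)) = 0 := by
      rw [linearMap_apply_eq_sum k]
      simp only [hk]
      exact congrFun hl j
    have hker : f.ker ≤ k.ker := by
      intro s hs
      obtain ⟨c, rfl⟩ := (hgf s).1 hs
      rw [LinearMap.mem_ker, linearMap_apply_eq_sum g, map_sum]
      exact Finset.sum_eq_zero fun j _ ↦ by rw [map_smul, hkg, smul_zero]
    let h : L' →ₗ[R] L :=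
      (f.ker.liftQ k hker).comp (f.quotKerEquivOfSurjective hf).symm.toLinearMap
    have hh (s : Fin n → R) : h (f s) = k s := by
      have : (f.quotKerEquivOfSurjective hf).symm (f s) = Submodule.Quotient.mk s := by
        rw [LinearEquiv.symm_apply_eq]
        rfl
      change f.ker.liftQ k hker ((f.quotKerEquivOfSurjective hf).symm (f s)) = _
      rw [this]
      rfl
    refine (hχ' l).trans (Eq.trans ?_ (hz (ModuleCat.ofHom h)))
    rw [map_sum]
    refine Finset.sum_congr rfl fun i _ ↦ ?_
    refine Eq.trans ?_ (pairing_tmul _ (χ i) _).symm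
    exact congrArg (χ i).eval ((hh _).trans (hk i)).symm
  let ψ' (j : Fin m) : DualType L :=
    AddMonoidHom.comp (M := L) (N := Fin m → L) ψ (AddMonoidHom.single (fun _ ↦ L) j)
  have hψ' (y : Fin m → L) : ∑ j, (ψ' j).eval (y j) = ψ y := by
    conv_rhs => rw [← Finset.univ_sum_single y]
    exact (map_sum ψ _ _).symm
  refine (Tensor.sum_eq_zero_iff hf hgf x).2 ⟨ψ', funext fun i ↦ ?_⟩
  refine DualType.ext fun l ↦ ?_
  refine Eq.trans ?_ (DualType.eval_sum _ _ l).symm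
  change (χ i).eval l = ∑ j, (ψ' j).eval (g (Pi.single j 1) i • l)
  rw [hψ' fun j ↦ g (Pi.single j 1) i • l]
  have h1 : ρ (Pi.single i l) = fun j ↦ g (Pi.single j 1) i • l := by
    funext j
    change ∑ k, g (Pi.single j 1) k • (Pi.single i l : Fin n → L) k = _
    rw [Finset.sum_eq_single_of_mem i (Finset.mem_univ i), Pi.single_eq_same]
    intro k _ hk
    rw [Pi.single_eq_of_ne hk, smul_zero]
  rw [← h1, hψ]
  refine Eq.symm ((hχ' _).trans ?_)
  rw [Finset.sum_eq_single_of_mem i (Finset.mem_univ i), Pi.single_eq_same]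
  intro k _ hk
  rw [Pi.single_eq_of_ne hk, map_zero]

/-- Maps to character modules separate elements from subfunctors of `M ⊗ -`. -/
lemma exists_map_rightDual {K : LFun R} {M : RMod R} (v : K ⟶ (t R).obj M) (L : FPLMod R)
    (z : Tensor M L.obj) (hz : ∀ k, v.hom.app L k ≠ z) :
    ∃ g : M ⟶ rightDual L.obj, v ≫ (t R).map g = 0 ∧ Tensor.map g (𝟙 L.obj) z ≠ 0 := by
  let V : AddSubgroup (Tensor M L.obj) := (v.hom.app L).hom.range
  have hz' : (QuotientAddGroup.mk z : Tensor M L.obj ⧸ V) ≠ 0 := fun h ↦ by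
    obtain ⟨k, hk⟩ := (QuotientAddGroup.eq_zero_iff _).1 h
    exact hz k hk
  obtain ⟨c, hc⟩ := CharacterModule.exists_character_apply_ne_zero_of_ne_zero hz'
  let φ : Tensor M L.obj →+ AddCircle (1 : ℚ) := AddMonoidHom.comp c (QuotientAddGroup.mk' V)
  -- By tensor-hom adjunction, `φ` is a morphism from `M` to the character module of `L`; `hg`
  -- recovers `φ` from it, naturally in the left module.
  let g : M ⟶ rightDual L.obj := ModuleCat.ofHom (Y := DualType L.obj)
    { toFun := fun m ↦ φ.comp (Tensor.tmul M L.obj m)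
      map_add' := fun m m' ↦ AddMonoidHom.ext fun l ↦ by simp; rfl
      map_smul' := fun r m ↦ AddMonoidHom.ext fun l ↦
        congrArg φ (Tensor.smul_tmul r.unop m l) }
  have hg {L' : ModuleCat.{u} R} (h : L' ⟶ L.obj) (y : Tensor M L') :
      pairing h (Tensor.map g (𝟙 L') y) = φ (Tensor.map (𝟙 M) h y) := by
    induction y using Tensor.induction_on with
    | zero => simp
    | tmul m l => rfl
    | add x y hx hy => rw [map_add, map_add, hx, hy, map_add, map_add]
  refine ⟨g, ?_, fun h ↦ ?_⟩
  · ext L' k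
    have := L'.property
    refine @eq_zero_of_pairing_eq_zero R _ L.obj L'.obj L'.property _ fun h ↦ ?_
    refine (hg h (v.hom.app L' k)).trans ?_
    let h' : L' ⟶ L := ObjectProperty.homMk h
    have h1 : Tensor.map (𝟙 M) h (v.hom.app L' k) = v.hom.app L (K.obj.map h' k) :=
      (app_map_apply v.hom h' k).symm
    rw [h1]
    refine (congrArg c ((QuotientAddGroup.eq_zero_iff _).2 ?_)).trans (map_zero c)
    exact ⟨_, rfl⟩
  · refine hc ?_
    have h1 := hg (𝟙 L.obj) z
    rw [h, map_zero] at h1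
    refine Eq.trans ?_ h1.symm
    refine congrArg φ ?_
    exact (ConcreteCategory.congr_hom (((t R).obj M).obj.map_id L) z).symm

end Tensor

/-! ### Kernel extensions -/

section Derived

variable {C : Type u₁} [Category.{v₁} C] [Preadditive C]
  {D : Type u₂} [Category.{v₂} D] [Preadditive D] [HasKernels D]

namespace kernelExtension

variable (T : C ⥤ D) [T.Additive]

/-- The inclusion of the kernel of `T X ⟶ T Y` into `T X`. -/
def ι (F : (FP C)ᵒᵖ) : (kernelExtension T).obj F ⟶ T.obj (pres F.unop).X :=
  kernel.ι (T.map (pres F.unop).f)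

instance (F : (FP C)ᵒᵖ) : Mono (ι T F) :=
  inferInstanceAs (Mono (kernel.ι (T.map (pres F.unop).f)))

lemma ι_comp_map (F : (FP C)ᵒᵖ) : ι T F ≫ T.map (pres F.unop).f = 0 :=
  kernel.condition _

variable {T} in
/-- The universal property of the kernel of `T X ⟶ T Y`. -/
def lift {F : (FP C)ᵒᵖ} {Z : D} (k : Z ⟶ T.obj (pres F.unop).X)
    (h : k ≫ T.map (pres F.unop).f = 0) : Z ⟶ (kernelExtension T).obj F :=
  kernel.lift _ k h

@[simp]
lemma lift_ι {F : (FP C)ᵒᵖ} {Z : D} (k : Z ⟶ T.obj (pres F.unop).X)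
    (h : k ≫ T.map (pres F.unop).f = 0) : lift k h ≫ ι T F = k :=
  kernel.lift_ι _ _ _

@[simp]
lemma lift_ι_assoc {F : (FP C)ᵒᵖ} {Z Z' : D} (k : Z ⟶ T.obj (pres F.unop).X)
    (h : k ≫ T.map (pres F.unop).f = 0) (g : T.obj (pres F.unop).X ⟶ Z') :
    lift k h ≫ ι T F ≫ g = k ≫ g := by
  rw [← Category.assoc, lift_ι]

lemma map_ι {F G : (FP C)ᵒᵖ} (φ : F ⟶ G) {a : (pres F.unop).X ⟶ (pres G.unop).X}
    (h : (pres G.unop).IsLift (pres F.unop) φ.unop.hom a) :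
    (kernelExtension T).map φ ≫ ι T G = ι T F ≫ T.map a :=
  kernelMap_ι T h

end kernelExtension

/-- A morphism between functors induces one between their kernel extensions. -/
def kernelExtensionMap {T T' : C ⥤ D} [T.Additive] [T'.Additive] (e : T ⟶ T') :
    kernelExtension T ⟶ kernelExtension T' where
  app F := kernelExtension.lift (kernelExtension.ι T F ≫ e.app _) (by
    rw [Category.assoc, ← e.naturality, ← Category.assoc, kernelExtension.ι_comp_map, zero_comp])
  naturality F G φ := by
    obtain ⟨a, ha⟩ := (pres G.unop).exists_isLift (pres F.unop) φ.unop.hom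
    rw [← cancel_mono (kernelExtension.ι T' G)]
    simp only [Category.assoc, kernelExtension.map_ι T' φ ha, kernelExtension.lift_ι,
      kernelExtension.lift_ι_assoc]
    rw [← Category.assoc, kernelExtension.map_ι T φ ha, Category.assoc, e.naturality]

@[simp]
lemma kernelExtensionMap_app_ι {T T' : C ⥤ D} [T.Additive] [T'.Additive] (e : T ⟶ T')
    (F : (FP C)ᵒᵖ) : (kernelExtensionMap e).app F ≫ kernelExtension.ι T' F =
      kernelExtension.ι T F ≫ e.app _ :=
  kernelExtension.lift_ι _ _ _

@[simp]
lemma kernelExtensionMap_app_ι_assoc {T T' : C ⥤ D} [T.Additive] [T'.Additive] (e : T ⟶ T')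
    (F : (FP C)ᵒᵖ) {Z : D} (g : T'.obj (pres F.unop).X ⟶ Z) :
    (kernelExtensionMap e).app F ≫ kernelExtension.ι T' F ≫ g =
      kernelExtension.ι T F ≫ e.app _ ≫ g := by
  rw [← Category.assoc, kernelExtensionMap_app_ι, Category.assoc]

/-- The kernel extensions of isomorphic functors are isomorphic. -/
def kernelExtensionIso {T T' : C ⥤ D} [T.Additive] [T'.Additive] (e : T ≅ T') :
    kernelExtension T ≅ kernelExtension T' where
  hom := kernelExtensionMap e.hom
  inv := kernelExtensionMap e.inv
  hom_inv_id := by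
    ext F
    rw [← cancel_mono (kernelExtension.ι T F)]
    simp
  inv_hom_id := by
    ext F
    rw [← cancel_mono (kernelExtension.ι T' F)]
    simp

section

variable (T : C ⥤ D) [T.Additive] {X : C}

/-- The universal element of a presentation of `(X, -)`, as a morphism. -/
def Presentation.eltHom (P : Presentation (preadditiveCoyoneda.obj (op X))) : X ⟶ P.X := P.elt

variable (P : Presentation (preadditiveCoyoneda.obj (op X)))

lemma Presentation.exists_section : ∃ s : P.X ⟶ X, P.eltHom ≫ s = 𝟙 X :=
  P.exists_map_elt (𝟙 X)

lemma Presentation.eltHom_comp_f : P.eltHom ≫ P.f = 0 := P.map_f_elt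

/-- Consequently `T.map (s ≫ P.eltHom)` acts as the identity on the kernel of `T.map P.f`.
Additivity of `T` suffices for this; no exactness is needed. -/
lemma Presentation.exists_section_relation (s : P.X ⟶ X) (hs : P.eltHom ≫ s = 𝟙 X) :
    ∃ b, P.f ≫ b = 𝟙 P.X - s ≫ P.eltHom := by
  apply P.exists_of_map_elt_eq_zero
  change P.eltHom ≫ (𝟙 P.X - s ≫ P.eltHom) = 0
  rw [Preadditive.comp_sub, ← Category.assoc, hs, Category.id_comp, Category.comp_id, sub_self]

/-- On representable functors, the kernel extension of `T` is `T`. -/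
def kernelRepresentableIso : T.obj X ≅ kernel (T.map P.f) where
  hom := kernel.lift _ (T.map P.eltHom) (by rw [← T.map_comp, P.eltHom_comp_f, T.map_zero])
  inv := kernel.ι _ ≫ T.map P.exists_section.choose
  hom_inv_id := by
    rw [kernel.lift_ι_assoc, ← T.map_comp, P.exists_section.choose_spec, T.map_id]
  inv_hom_id := by
    obtain ⟨b, hb⟩ := P.exists_section_relation _ P.exists_section.choose_spec
    have h : kernel.ι (T.map P.f) ≫ T.map (𝟙 _ - P.exists_section.choose ≫ P.eltHom) = 0 := by
      rw [← hb, T.map_comp, kernel.condition_assoc, zero_comp]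
    rw [T.map_sub, Preadditive.comp_sub, T.map_id, Category.comp_id] at h
    rw [← cancel_mono (kernel.ι _), Category.assoc, kernel.lift_ι, Category.id_comp,
      Category.assoc, ← T.map_comp]
    exact (sub_eq_zero.1 h).symm

lemma kernelRepresentableIso_hom_ι :
    (kernelRepresentableIso T P).hom ≫ kernel.ι _ = T.map P.eltHom :=
  kernel.lift_ι _ _ _

end

/-- The kernel extension of `T` extends `T` along the Yoneda embedding. -/
def yonedaKernelExtensionIso (T : C ⥤ D) [T.Additive] : T ≅ yonedaFP C ⋙ kernelExtension T :=
  NatIso.ofComponents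
    (fun X ↦ kernelRepresentableIso T (X := X) (pres ((yonedaFP C).obj X).unop)) fun {X Y} f ↦ by
    let P (X : C) : Presentation (preadditiveCoyoneda.obj (op X)) :=
      pres ((yonedaFP C).obj X).unop
    obtain ⟨a, ha⟩ := (P Y).exists_isLift (P X) (preadditiveCoyoneda.map f.op)
    have ha' : f ≫ (P Y).eltHom = (P X).eltHom ≫ a := ha.symm
    have h : (kernelRepresentableIso T (P X)).hom ≫ kernelMap T (P Y) (P X)
        (preadditiveCoyoneda.map f.op) = T.map f ≫ (kernelRepresentableIso T (P Y)).hom := by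
      rw [← cancel_mono (kernel.ι _), Category.assoc, kernelMap_ι T ha, ← Category.assoc,
        kernelRepresentableIso_hom_ι, Category.assoc, kernelRepresentableIso_hom_ι,
        ← T.map_comp, ← T.map_comp, ha']
    exact h.symm

end Derived

section Functors

variable {R : Type u} [Ring R]

/-! ### Finite presentation of `D_R G` -/

/-- The elements of `(D_R G)(M)` are the natural transformations `G ⟶ M ⊗ -`. -/
def DREquiv (G : (LFun R)ᵒᵖ) (M : RMod R) :
    (G.unop ⟶ (t R).obj M) ≃+ ((DR R).obj G).obj M :=
  natEquiv _ _

lemma DR_map_apply (G : (LFun R)ᵒᵖ) {M N : RMod R} (f : M ⟶ N) (θ : G.unop ⟶ (t R).obj M) :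
    ((DR R).obj G).map f (DREquiv G _ θ) = DREquiv _ _ (θ ≫ (t R).map f) := by
  refine (natGrpMap_apply _ _ θ).trans ?_
  rw [Category.id_comp]
  rfl

lemma DR_app_apply {G G' : (LFun R)ᵒᵖ} (α : G ⟶ G') {M : RMod R} (θ : G.unop ⟶ (t R).obj M) :
    ((DR R).map α).app M (DREquiv G _ θ) = DREquiv _ _ (α.unop ≫ θ) := by
  refine (natGrpMap_apply _ _ θ).trans ?_
  rw [Category.comp_id]
  rfl

instance (G : (LFun R)ᵒᵖ) : ((DR R).obj G).Additive where
  map_add {M N f g} := natGrp_ext fun θ ↦ by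
    refine (DR_map_apply G (f + g) θ).trans ?_
    rw [(t R).map_add, Preadditive.comp_add, map_add]
    exact congrArg₂ (· + ·) (DR_map_apply G f θ).symm (DR_map_apply G g θ).symm

/-- Evaluation of natural transformations `G ⟶ - ⊗ _` at an element of `G L`. -/
def evalDR (G : (LFun R)ᵒᵖ) (L : FPLMod R) (g : G.unop.obj.obj L) :
    (DR R).obj G ⟶ tensorRight L where
  app M := AddCommGrpCat.ofHom
    (AddMonoidHom.mk' (fun θ ↦ ((DREquiv G _).symm θ).hom.app L g)
      fun θ θ' ↦ congrArg (fun σ ↦ σ.hom.app L g) (map_add (DREquiv G M).symm θ θ'))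
  naturality M N f := natGrp_ext fun θ ↦ by
    change ((DREquiv G _).symm (((DR R).obj G).map f (DREquiv G _ θ))).hom.app L g =
      Tensor.map f (𝟙 L.obj) (((DREquiv G _).symm (DREquiv G _ θ)).hom.app L g)
    rw [DR_map_apply, AddEquiv.symm_apply_apply, AddEquiv.symm_apply_apply]
    rfl

lemma evalDR_apply (G : (LFun R)ᵒᵖ) (L : FPLMod R) (g : G.unop.obj.obj L) {M : RMod R}
    (θ : G.unop ⟶ (t R).obj M) :
    (evalDR G L g).app M (DREquiv G _ θ) = θ.hom.app L g := by
  change ((DREquiv G _).symm (DREquiv G _ θ)).hom.app L g = _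
  rw [AddEquiv.symm_apply_apply]

/-- The action of a morphism of left modules on tensor functors. -/
def tensorRightMap {L L' : FPLMod R} (h : L ⟶ L') : tensorRight L ⟶ tensorRight L' where
  app M := AddCommGrpCat.ofHom (Tensor.map (𝟙 M) h.hom)
  naturality M N f := by
    ext : 1
    exact Tensor.ext fun m l ↦ rfl

/-- A family of transformations induces one into the product. -/
def piLift {C : Type u₁} [Category.{v₁} C] {I : Type v₁} {H : C ⥤ AddCommGrpCat.{v₁}}
    {F : I → C ⥤ AddCommGrpCat.{v₁}} (φ : ∀ i, H ⟶ F i) : H ⟶ piFunctor F where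
  app A := AddCommGrpCat.ofHom (AddMonoidHom.pi fun i ↦ ((φ i).app A).hom)
  naturality A B f := by
    ext x
    exact funext fun i ↦ app_map_apply (φ i) f x

/-- The projections of a product of functors. -/
def piProj {C : Type u₁} [Category.{v₁} C] {I : Type v₁}
    (F : I → C ⥤ AddCommGrpCat.{v₁}) (i : I) : piFunctor F ⟶ F i where
  app A := AddCommGrpCat.ofHom (Pi.evalAddMonoidHom _ i)

section

variable (G : (LFun R)ᵒᵖ)

/-- The left module corresponding to an object of the small model. -/
abbrev modelObj (s : SmallModel.{u} (FPLMod R)) : FPLMod R :=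
  (equivSmallModel.{u} (FPLMod R)).inverse.obj s

/-- The elements of a functor on finitely presented left modules. -/
abbrev Elements : Type u := Σ s : SmallModel.{u} (FPLMod R), G.unop.obj.obj (modelObj s)

/-- Pairs of elements of a functor on finitely presented left modules, over the same object. -/
abbrev ElementPairs : Type u :=
  Σ s : SmallModel.{u} (FPLMod R), G.unop.obj.obj (modelObj s) × G.unop.obj.obj (modelObj s)

/-- Elements of a functor on finitely presented left modules with a morphism to act on them. -/
abbrev ElementArrows : Type u :=
  Σ (s s' : SmallModel.{u} (FPLMod R)), (s ⟶ s') × G.unop.obj.obj (modelObj s)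

/-- The map whose kernel consists of the additive and natural families. -/
def relations :
    piFunctor (fun i : Elements G ↦ tensorRight (modelObj i.1)) ⟶
      piFunctor (fun j : ElementPairs G ⊕ ElementArrows G ↦
        tensorRight (modelObj (j.elim (fun j ↦ j.1) (fun j ↦ j.2.1)))) :=
  let p (i : Elements G) := piProj (fun i : Elements G ↦ tensorRight (modelObj i.1)) i
  piLift fun j ↦ match j with
    | Sum.inl j => p ⟨j.1, j.2.1 + j.2.2⟩ - (p ⟨j.1, j.2.1⟩ + p ⟨j.1, j.2.2⟩)
    | Sum.inr j =>
      p ⟨j.2.1, G.unop.obj.map ((equivSmallModel.{u} (FPLMod R)).inverse.map j.2.2.1) j.2.2.2⟩ -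
        p ⟨j.1, j.2.2.2⟩ ≫ tensorRightMap ((equivSmallModel.{u} (FPLMod R)).inverse.map j.2.2.1)

lemma relations_apply_eq_zero_iff {M : RMod R}
    (x : ∀ i : Elements G, Tensor M (modelObj i.1).obj) :
    (relations G).app M x = 0 ↔
      (∀ s g g', x ⟨s, g + g'⟩ = x ⟨s, g⟩ + x ⟨s, g'⟩) ∧
      ∀ (s s' : SmallModel.{u} (FPLMod R)) (h : s ⟶ s') g,
        x ⟨s', G.unop.obj.map ((equivSmallModel.{u} (FPLMod R)).inverse.map h) g⟩ =
          Tensor.map (𝟙 M) ((equivSmallModel.{u} (FPLMod R)).inverse.map h).hom (x ⟨s, g⟩) := by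
  constructor
  · intro h
    exact ⟨fun s g g' ↦ sub_eq_zero.1 (congrFun h (Sum.inl ⟨s, g, g'⟩)),
      fun s s' k g ↦ sub_eq_zero.1 (congrFun h (Sum.inr ⟨s, s', k, g⟩))⟩
  · rintro ⟨h1, h2⟩
    funext j
    match j with
    | Sum.inl j => exact sub_eq_zero.2 (h1 j.1 j.2.1 j.2.2)
    | Sum.inr j => exact sub_eq_zero.2 (h2 j.1 j.2.1 j.2.2.1 j.2.2.2)

/-- The family of values of a natural transformation. -/
def evalFamily : (DR R).obj G ⟶ piFunctor (fun i : Elements G ↦ tensorRight (modelObj i.1)) :=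
  piLift fun i ↦ evalDR G (modelObj i.1) i.2

lemma evalFamily_apply {M : RMod R} (θ : G.unop ⟶ (t R).obj M) (i : Elements G) :
    (show ∀ i : Elements G, Tensor M (modelObj i.1).obj from
      (evalFamily G).app M (DREquiv G _ θ)) i = θ.hom.app (modelObj i.1) i.2 :=
  evalDR_apply G _ _ θ

/-- A transformation `G ⟶ M ⊗ -` is a family of elements of the groups `M ⊗ L`, indexed by the
elements of `G`, subject to additivity and naturality. Indexing by a small model of the finitely
presented left modules keeps the products in the universe of `R`. -/
lemma isFP_DR : IsFP ((DR R).obj G) := by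
  let e := equivSmallModel.{u} (FPLMod R)
  let W := (Functor.whiskeringLeft _ _ AddCommGrpCat.{u}).obj e.inverse
  refine IsFP.of_kernel (evalFamily G) (relations G) ?_ ?_
    (IsFP.piFunctor fun i ↦ isFP_tensorRight _) (IsFP.piFunctor fun i ↦ isFP_tensorRight _)
  · intro M θ θ' h
    obtain ⟨θ, rfl⟩ := (DREquiv _ _).surjective θ
    obtain ⟨θ', rfl⟩ := (DREquiv _ _).surjective θ'
    refine congrArg _ ?_
    ext : 1
    apply W.map_injective
    ext s g
    have := congrFun h ⟨s, g⟩
    exact (evalFamily_apply G θ ⟨s, g⟩).symm.trans (this.trans (evalFamily_apply G θ' ⟨s, g⟩))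
  · intro M x
    refine (relations_apply_eq_zero_iff G x).trans ?_
    constructor
    · rintro ⟨h1, h2⟩
      let τ : W.obj G.unop.obj ⟶ W.obj ((t R).obj M).obj :=
        { app := fun s ↦ AddCommGrpCat.ofHom (AddMonoidHom.mk' (fun g ↦ x ⟨s, g⟩) (h1 s))
          naturality := fun s s' k ↦ by
            ext g
            exact h2 s s' k g }
      let θ : G.unop ⟶ (t R).obj M := ObjectProperty.homMk (W.preimage τ)
      refine ⟨DREquiv _ _ θ, funext fun i ↦ (evalFamily_apply G θ i).trans ?_⟩
      have := congrArg (fun σ ↦ σ.app i.1) (W.map_preimage τ)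
      exact ConcreteCategory.congr_hom this i.2
    · rintro ⟨θ, rfl⟩
      obtain ⟨θ, rfl⟩ := (DREquiv _ _).surjective θ
      refine ⟨fun s g g' ↦ ?_, fun s s' k g ↦ ?_⟩
      · refine (evalFamily_apply G θ ⟨s, g + g'⟩).trans ((map_add _ _ _).trans ?_)
        exact congrArg₂ (· + ·) (evalFamily_apply G θ ⟨s, g⟩).symm
          (evalFamily_apply G θ ⟨s, g'⟩).symm
      · refine (evalFamily_apply G θ ⟨s', _⟩).trans ((app_map_apply θ.hom _ g).trans ?_)
        exact congrArg (Tensor.map _ _) (evalFamily_apply G θ ⟨s, g⟩).symm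

end

/-! ### The adjunction -/

lemma DR_map_eq_zero_iff (G : (LFun R)ᵒᵖ) {M N : RMod R} (f : M ⟶ N)
    (θ : G.unop ⟶ (t R).obj M) :
    ((DR R).obj G).map f (DREquiv G _ θ) = 0 ↔ θ ≫ (t R).map f = 0 := by
  rw [DR_map_apply]
  exact map_eq_zero_iff _ (DREquiv _ _).injective

lemma DR_map_comp_ι (G : (LFun R)ᵒᵖ) (F : FP (RMod R))
    (θ : G.unop ⟶ (kernelExtension (t R)).obj (op F)) :
    ((DR R).obj G).map (pres F).f (DREquiv G _ (θ ≫ kernelExtension.ι (t R) (op F))) = 0 :=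
  (DR_map_eq_zero_iff G _ _).2 (by
    rw [Category.assoc]
    exact (congrArg _ (kernelExtension.ι_comp_map (t R) (op F))).trans comp_zero)

variable (R) in
/-- The bijection `Nat(G, ker (t X ⟶ t Y)) ≃ Nat(F, D_R G)`. -/
def kernelHomEquiv (h : ∀ G : (LFun R)ᵒᵖ, IsFP ((DR R).obj G)) (F : FP (RMod R))
    (G : (LFun R)ᵒᵖ) :
    (op ((kernelExtension (t R)).obj (op F)) ⟶ G) ≃ (F ⟶ (DRfp R h).obj G) where
  toFun θ := ObjectProperty.homMk ((pres F).homEquiv (H := (DR R).obj G)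
    ⟨DREquiv G _ (θ.unop ≫ kernelExtension.ι (t R) (op F)), DR_map_comp_ι G F θ.unop⟩)
  invFun φ := Quiver.Hom.op (kernelExtension.lift
    ((DREquiv G _).symm (φ.hom.app _ (pres F).elt)) ((DR_map_eq_zero_iff G _ _).1
      ((congrArg (((DR R).obj G).map (pres F).f) (AddEquiv.apply_symm_apply _ _)).trans
        (((pres F).homEquiv (H := (DR R).obj G)).symm φ.hom).2)))
  left_inv θ := by
    apply Quiver.Hom.unop_inj
    rw [← cancel_mono (kernelExtension.ι (t R) (op F))]
    refine (kernelExtension.lift_ι (t R) (F := op F) _ _).trans ?_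
    exact (DREquiv G _).symm_apply_eq.2 ((pres F).homEquiv_elt (H := (DR R).obj G) _)
  right_inv φ := by
    ext : 1
    refine (pres F).hom_ext (((pres F).homEquiv_elt (H := (DR R).obj G) _).trans ?_)
    refine (congrArg (DREquiv G _) (kernelExtension.lift_ι (t R) (F := op F) _ _)).trans ?_
    exact AddEquiv.apply_symm_apply _ _

variable {h : ∀ G : (LFun R)ᵒᵖ, IsFP ((DR R).obj G)}

lemma kernelHomEquiv_elt {F : FP (RMod R)} {G : (LFun R)ᵒᵖ}
    (θ : op ((kernelExtension (t R)).obj (op F)) ⟶ G) :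
    (kernelHomEquiv R h F G θ).hom.app _ (pres F).elt =
      DREquiv G _ (θ.unop ≫ kernelExtension.ι (t R) (op F)) :=
  (pres F).homEquiv_elt (H := (DR R).obj G) ⟨_, DR_map_comp_ι G F θ.unop⟩

variable (R h) in
/-- The bijections defining the adjunction between the kernel extension of the tensor embedding
and `D_R`. -/
def kernelCoreHomEquiv :
    Adjunction.CoreHomEquiv (kernelExtension (t R)).rightOp (DRfp R h) where
  homEquiv := kernelHomEquiv R h
  homEquiv_naturality_left_symm := fun {F' F G} φ ψ ↦ by
    obtain ⟨θ, rfl⟩ := (kernelHomEquiv R h F G).surjective ψ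
    rw [Equiv.symm_apply_apply, Equiv.symm_apply_eq]
    ext : 1
    refine (pres F').hom_ext ?_
    refine Eq.trans ?_ (kernelHomEquiv_elt _).symm
    obtain ⟨a, ha⟩ := (pres F').exists_isLift (pres F) φ.hom
    have h1 : ((kernelExtension (t R)).rightOp.map φ ≫ θ).unop ≫
        kernelExtension.ι (t R) (op F') =
          (θ.unop ≫ kernelExtension.ι (t R) (op F)) ≫ (t R).map a := by
      rw [Category.assoc]
      exact (Category.assoc _ _ _).trans
        (congrArg _ (kernelExtension.map_ι (t R) (F := op F) (G := op F') φ.op ha))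
    rw [h1]
    refine Eq.trans ?_ (DR_map_apply G a _)
    rw [← kernelHomEquiv_elt (h := h)]
    refine (congrArg ((kernelHomEquiv R h F G θ).hom.app _) ha).symm.trans ?_
    exact app_map_apply (kernelHomEquiv R h F G θ).hom a (pres F).elt
  homEquiv_naturality_right := fun {F G G'} θ α ↦ by
    ext : 1
    refine (pres F).hom_ext ((kernelHomEquiv_elt _).trans ?_)
    refine Eq.trans ?_ (congrArg (((DR R).map α).app _) (kernelHomEquiv_elt θ).symm)
    refine Eq.trans ?_ (DR_app_apply α _).symm
    exact congrArg _ (Category.assoc _ _ _)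

variable (R h) in
/-- The adjunction between the kernel extension of the tensor embedding and `D_R`. -/
def kernelAdjunction : (kernelExtension (t R)).rightOp ⊣ DRfp R h :=
  Adjunction.mkOfHomEquiv (kernelCoreHomEquiv R h)

/-- The unit is the transpose of the identity. This value determines it, and it is what both purity
arguments below use. -/
lemma kernelAdjunction_unit_elt (F : FP (RMod R)) :
    ((kernelAdjunction R h).unit.app F).hom.app _ (pres F).elt =
      DREquiv _ _ (kernelExtension.ι (t R) (op F)) := by
  have : (kernelAdjunction R h).unit.app F = kernelHomEquiv R h F _ (𝟙 _) := by
    rw [← Adjunction.homEquiv_id, kernelAdjunction, Adjunction.mkOfHomEquiv_homEquiv]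
    rfl
  rw [this]
  refine (kernelHomEquiv_elt _).trans ?_
  exact congrArg _ (Category.id_comp _)

end Functors

/-- `D_A` is the kernel extension of the tensor embedding. -/
def DAIso (R : Type u) [Ring R] : kernelExtension (t R) ≅ DA R :=
  -- The case `𝟭` of `yonedaKernelExtensionIso` says that `w` sends `(X, -)` back to `X`, so `t ∘ w`
  -- restricts to `t` on representables.
  kernelExtensionIso (T := t R) (T' := yonedaFP (RMod R) ⋙ w R ⋙ t R)
    (Functor.isoWhiskerRight (yonedaKernelExtensionIso (𝟭 (RMod R))) (t R))

section Functors

variable {R : Type u} [Ring R]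

/-! ### Functors annihilated by `D_A` -/

lemma Tensor.tmul_one_injective (M : RMod R) :
    Function.Injective fun m ↦ Tensor.tmul M (ModuleCat.of R R) m (1 : R) := by
  let φ : Tensor M (ModuleCat.of R R) →+ M := Tensor.lift
    (AddMonoidHom.mk' (fun m ↦ AddMonoidHom.mk' (fun r : R ↦ MulOpposite.op r • m)
      fun r s ↦ by rw [MulOpposite.op_add, add_smul]) fun m m' ↦ by
        ext r
        exact smul_add (MulOpposite.op (r : R)) m m')
    fun r m s ↦ (mul_smul (MulOpposite.op (s : R)) (MulOpposite.op r) m).symm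
  have hφ (m : M) : φ (Tensor.tmul M (ModuleCat.of R R) m (1 : R)) = m :=
    one_smul Rᵐᵒᵖ m
  intro m m' h
  exact (hφ m).symm.trans ((congrArg φ h).trans (hφ m'))

/-- A morphism of right modules is a pure monomorphism if it stays injective after tensoring with
every finitely presented left module. -/
def IsPureMono {X Y : RMod R} (f : X ⟶ Y) : Prop :=
  ∀ (L : FPLMod R) (z : Tensor X L.obj), Tensor.map f (𝟙 L.obj) z = 0 → z = 0

/-- Purity is tested on `L = R`, where `x ↦ x ⊗ 1` is injective. -/
lemma IsPureMono.mono {X Y : RMod R} {f : X ⟶ Y} (hf : IsPureMono f) : Mono f := by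
  rw [ModuleCat.mono_iff_injective]
  refine (injective_iff_map_eq_zero f.hom).2 fun x hx ↦ ?_
  let L : FPLMod R := ⟨ModuleCat.of R R, inferInstanceAs (Module.FinitePresentation R R)⟩
  refine Tensor.tmul_one_injective X ((hf L (Tensor.tmul X L.obj x (1 : R)) ?_).trans ?_)
  · refine (Tensor.map_tmul f (𝟙 L.obj) x (1 : R)).trans ?_
    have : f x = 0 := hx
    rw [this, map_zero]
    rfl
  · exact (DFunLike.congr_fun (map_zero (Tensor.tmul X L.obj)) (1 : R)).symm

/-- The sequence is completed by the cokernel of `P.f`. Right exactness of the tensor product and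
left exactness of `Hom` supply everything beyond purity. -/
lemma IsPureMono.arisesFromPureExact {F : RMod R ⥤ AddCommGrpCat.{u}} (P : Presentation F)
    (hP : IsPureMono P.f) : ArisesFromPureExact F := by
  have := hP.mono
  let S : ShortComplex (RMod R) := ShortComplex.mk P.f (cokernel.π P.f) (cokernel.condition _)
  have hS : S.ShortExact :=
    { exact := S.exact_of_g_is_cokernel (cokernelIsCokernel P.f)
      mono_f := this
      epi_g := inferInstanceAs (Epi (cokernel.π P.f)) }
  have hex : Function.Exact S.f S.g :=
    (ShortComplex.ShortExact.moduleCat_exact_iff_function_exact S).1 hS.exact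
  have hsurj : Function.Surjective S.g := (ModuleCat.epi_iff_surjective _).1 hS.epi_g
  refine ⟨S, ⟨hS, fun L ↦ ?_, fun L ↦ Tensor.map_exact hex hsurj,
    fun L ↦ Tensor.map_surjective hsurj⟩, P.π, fun A ↦ ⟨?_, ?_, P.exact A, P.surj A⟩⟩
  · exact (injective_iff_map_eq_zero (Tensor.map P.f (𝟙 L.obj))).2 (hP L)
  · intro u v h
    have h' : cokernel.π P.f ≫ u = cokernel.π P.f ≫ v := h
    exact (cancel_epi _).1 h'
  · intro u
    constructor
    · intro h
      exact ⟨cokernel.desc P.f u h, cokernel.π_desc P.f u h⟩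
    · rintro ⟨v, rfl⟩
      have key (w : cokernel P.f ⟶ A) : P.f ≫ cokernel.π P.f ≫ w = 0 := by
        rw [← Category.assoc, cokernel.condition, zero_comp]
      exact key v

/-! ### Objectwise kernels of tensor functors -/

/-- The representable functor `(L, -)`. -/
def representable (L : FPLMod R) : LFun R :=
  ⟨preadditiveCoyoneda.obj (op L), inferInstanceAs (preadditiveCoyoneda.obj (op L)).Additive⟩

/-- The transformation `(L, -) ⟶ G` determined by an element of `G L`. -/
def ofElement {G : LFun R} {L : FPLMod R} (x : G.obj.obj L) : representable L ⟶ G :=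
  ObjectProperty.homMk (ofElt (F := G.obj) x)

lemma ofElement_apply {G : LFun R} {L : FPLMod R} (x : G.obj.obj L) :
    (ofElement x).hom.app L (𝟙 L) = x :=
  ConcreteCategory.congr_hom (G.obj.map_id L) x

lemma representable_hom_ext {G : LFun R} {L : FPLMod R} {φ ψ : representable L ⟶ G}
    (h : φ.hom.app L (𝟙 L) = ψ.hom.app L (𝟙 L)) : φ = ψ := by
  ext : 1
  refine (presRepresentable L).hom_ext ?_
  exact h

/-- Elements of `G L` are morphisms from `(L, -)`, so a monomorphism is tested on them. -/
lemma injective_app_of_mono {G H : LFun R} (i : G ⟶ H) [Mono i] (L : FPLMod R) :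
    Function.Injective (i.hom.app L) := by
  intro x y h
  have : ofElement x = ofElement y := by
    rw [← cancel_mono i]
    apply representable_hom_ext
    have hx := congrArg (i.hom.app L) (ofElement_apply x)
    have hy := congrArg (i.hom.app L) (ofElement_apply y)
    exact hx.trans (h.trans hy.symm)
  rw [← ofElement_apply x, this, ofElement_apply]

/-- The categorical kernel is objectwise: by Yoneda `x` is a morphism from `(L, -)`, which the
universal property lifts. -/
lemma exists_ι_apply_eq (F : FP (RMod R)) (L : FPLMod R)
    (x : Tensor (pres F).X L.obj) (hx : Tensor.map (pres F).f (𝟙 L.obj) x = 0) :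
    ∃ k, (kernelExtension.ι (t R) (op F)).hom.app L k = x := by
  let φ : representable L ⟶ (t R).obj (pres F).X := ofElement (G := (t R).obj (pres F).X) x
  have hφ : φ.hom.app L (𝟙 L) = x := ofElement_apply (G := (t R).obj (pres F).X) x
  have h : φ ≫ (t R).map (pres F).f = 0 := by
    apply representable_hom_ext
    exact (congrArg (Tensor.map (pres F).f (𝟙 L.obj)) hφ).trans hx
  refine ⟨(kernelExtension.lift (F := op F) φ h).hom.app L (𝟙 L), Eq.trans ?_ hφ⟩
  exact congrArg (fun σ : representable L ⟶ (t R).obj (pres F).X ↦ σ.hom.app L (𝟙 L))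
    (kernelExtension.lift_ι (t R) (F := op F) φ h)

lemma isZero_kernelExtension {F : FP (RMod R)} (h : IsPureMono (pres F).f) :
    IsZero ((kernelExtension (t R)).obj (op F)) := by
  rw [IsZero.iff_id_eq_zero, ← cancel_mono (kernelExtension.ι (t R) (op F)), Category.id_comp,
    zero_comp]
  ext L k
  refine h L _ ?_
  exact congrArg (fun σ : (kernelExtension (t R)).obj (op F) ⟶ (t R).obj (pres F).Y ↦
    σ.hom.app L k) (kernelExtension.ι_comp_map (t R) (op F))

lemma isZero_DA {F : FP (RMod R)} (h : IsPureMono (pres F).f) : IsZero ((DA R).obj (op F)) :=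
  (isZero_kernelExtension h).of_iso ((DAIso R).app (op F)).symm

/-! ### The kernel and the cokernel of the unit -/

section

variable {h : ∀ G : (LFun R)ᵒᵖ, IsFP ((DR R).obj G)}

/-- Monomorphisms of finitely presented functors are lifted to solutions of the tensored
relations. -/
lemma exists_tensor_lift {E F : FP (RMod R)} {i : E.obj ⟶ F.obj}
    (hi : ∀ A, Function.Injective (i.app A)) {a : (pres F).X ⟶ (pres E).X}
    (ha : (pres E).IsLift (pres F) i a) (L : FPLMod R) (z : Tensor (pres E).X L.obj)
    (hz : Tensor.map (pres E).f (𝟙 L.obj) z = 0) :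
    ∃ x, Tensor.map a (𝟙 L.obj) x = z ∧ Tensor.map (pres F).f (𝟙 L.obj) x = 0 := by
  have := E.property.additive
  have := F.property.additive
  -- The cokernel of `v` is the pushout of `a` and `(pres F).f`, up to the sign in `hg`. The element
  -- of `E` defined by `g` dies in `F`, hence already in `E`, so `g` factors through `(pres E).f`
  -- and kills `z`. Right exactness then writes `(z, 0)` as the image of some `x` under `v ⊗ L`.
  let v : (pres F).X ⟶ (pres E).X ⊞ (pres F).Y := biprod.lift a (pres F).f
  let g : (pres E).X ⟶ cokernel v := biprod.inl ≫ cokernel.π v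
  have hg : a ≫ g = (pres F).f ≫ (-(biprod.inr ≫ cokernel.π v)) := by
    rw [Preadditive.comp_neg, eq_neg_iff_add_eq_zero, ← Category.assoc, ← Category.assoc,
      ← Preadditive.add_comp, ← biprod.lift_eq]
    exact cokernel.condition v
  have hg' : E.obj.map g (pres E).elt = 0 := by
    apply hi
    rw [app_map_apply, ← ha, ← map_comp_apply, hg, map_comp_apply, Presentation.map_f_elt,
      map_zero, map_zero]
  obtain ⟨c, hc⟩ := (pres E).exists_of_map_elt_eq_zero g hg'
  have hv : Function.Exact v (cokernel.π v) :=
    (ShortComplex.ShortExact.moduleCat_exact_iff_function_exact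
      (ShortComplex.mk v (cokernel.π v) (cokernel.condition v))).1
      (ShortComplex.exact_of_g_is_cokernel _ (cokernelIsCokernel v))
  have map_comp {A B D : RMod R} (p : A ⟶ B) (q : B ⟶ D) (y : Tensor A L.obj) :
      Tensor.map (p ≫ q) (𝟙 L.obj) y = Tensor.map q (𝟙 L.obj) (Tensor.map p (𝟙 L.obj) y) :=
    map_comp_apply (F := tensorRight L) p q y
  have map_id {A : RMod R} (y : Tensor A L.obj) : Tensor.map (𝟙 A) (𝟙 L.obj) y = y :=
    ConcreteCategory.congr_hom ((tensorRight L).map_id A) y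
  have map_zero' {A B : RMod R} (y : Tensor A L.obj) :
      Tensor.map (0 : A ⟶ B) (𝟙 L.obj) y = 0 :=
    map_zero_apply (F := tensorRight L) y
  obtain ⟨x, hx⟩ := (Tensor.map_exact (L := L.obj) hv
    ((ModuleCat.epi_iff_surjective (cokernel.π v)).1 inferInstance)
    (Tensor.map biprod.inl (𝟙 L.obj) z)).1 (by
      rw [← map_comp]
      change Tensor.map g (𝟙 L.obj) z = 0
      rw [← hc, map_comp, hz, map_zero])
  refine ⟨x, ?_, ?_⟩
  · have := congrArg (Tensor.map biprod.fst (𝟙 L.obj)) hx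
    rwa [← map_comp, ← map_comp, biprod.lift_fst, biprod.inl_fst, map_id] at this
  · have := congrArg (Tensor.map biprod.snd (𝟙 L.obj)) hx
    rwa [← map_comp, ← map_comp, biprod.lift_snd, biprod.inl_snd, map_zero'] at this

/-- On the universal element of `E`, the composite with the unit is `D_A F ⟶ X_F ⊗ - ⟶ X_E ⊗ -`. So
this vanishes, while `exists_tensor_lift` puts every `z` killed by the relations in its image. -/
lemma isPureMono_of_comp_unit_eq_zero {E F : FP (RMod R)} (i : E ⟶ F)
    (hi : ∀ A, Function.Injective (i.hom.app A))
    (h0 : i ≫ (kernelAdjunction R h).unit.app F = 0) : IsPureMono (pres E).f := by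
  intro L z hz
  obtain ⟨a, ha⟩ := (pres E).exists_isLift (pres F) i.hom
  obtain ⟨x, rfl, hx⟩ := exists_tensor_lift hi ha L z hz
  obtain ⟨k, rfl⟩ := exists_ι_apply_eq F L x hx
  let δ := ((kernelAdjunction R h).unit.app F).hom
  have h1 : δ.app _ (i.hom.app _ (pres E).elt) = 0 :=
    congrArg (fun σ : E ⟶ _ ↦ σ.hom.app _ (pres E).elt) h0
  have h2 : δ.app _ (F.obj.map a (pres F).elt) =
      ((DR R).obj (op ((kernelExtension (t R)).obj (op F)))).map a (δ.app _ (pres F).elt) :=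
    app_map_apply δ a _
  have h3 := (congrArg (((DR R).obj (op ((kernelExtension (t R)).obj (op F)))).map a)
    (kernelAdjunction_unit_elt (h := h) F)).symm.trans (h2.symm.trans ((congrArg _ ha).trans h1))
  have h4 := (DR_map_eq_zero_iff _ a _).1 h3
  exact congrArg (fun σ : (kernelExtension (t R)).obj (op F) ⟶ (t R).obj (pres E).X ↦
    σ.hom.app L k) h4

/-- Let `v : G ⟶ X ⊗ -` be the universal element of a presentation of `D_R G`. If `β` sends it to `v
k`, naturality makes `β` evaluation at `k`. Otherwise `exists_map_rightDual` gives `g` with `v ≫ (g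
⊗ -) = 0` that does not kill the value of `β`, against naturality. -/
lemma exists_eq_eval (G : (LFun R)ᵒᵖ) (L : FPLMod R)
    (β : (DR R).obj G ⟶ tensorRight L) :
    ∃ k : G.unop.obj.obj L, ∀ (M : RMod R) (θ : G.unop ⟶ (t R).obj M),
      β.app M (DREquiv G M θ) = θ.hom.app L k := by
  obtain ⟨P⟩ := isFP_DR G
  obtain ⟨v, hv⟩ := (DREquiv G P.X).surjective P.elt
  by_cases hk : ∃ k, v.hom.app L k = β.app P.X P.elt
  · obtain ⟨k, hk⟩ := hk
    refine ⟨k, fun M θ ↦ ?_⟩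
    obtain ⟨g, hg⟩ := P.exists_map_elt (DREquiv G M θ)
    rw [← hg, app_map_apply, ← hk]
    rw [← hv, DR_map_apply] at hg
    rw [← (DREquiv G M).injective hg]
    rfl
  · obtain ⟨g, hg, hz⟩ := exists_map_rightDual v L (β.app P.X P.elt) fun k hk' ↦ hk ⟨k, hk'⟩
    refine absurd ?_ hz
    have h1 : ((DR R).obj G).map g P.elt = 0 := by
      rw [← hv]
      exact (DR_map_eq_zero_iff G g v).2 hg
    have h2 : β.app _ (((DR R).obj G).map g P.elt) =
      Tensor.map g (𝟙 L.obj) (β.app P.X P.elt) := app_map_apply β g P.elt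
    rw [← h2, h1, map_zero]
    rfl

/-- If `β` is evaluation at `k`, its value at the image of the universal element of `F` is `k` seen
in `X_F ⊗ L`, and `D_A F ⟶ X_F ⊗ -` is injective. -/
lemma eq_zero_of_unit_comp_eq_zero (F : FP (RMod R)) (L : FPLMod R)
    (β : ((DRfp R h).obj (op ((kernelExtension (t R)).obj (op F)))).obj ⟶ tensorRight L)
    (hβ : ((kernelAdjunction R h).unit.app F).hom ≫ β = 0) : β = 0 := by
  obtain ⟨k, hk⟩ := exists_eq_eval (op ((kernelExtension (t R)).obj (op F))) L β
  have h1 : β.app _ (((kernelAdjunction R h).unit.app F).hom.app _ (pres F).elt) = 0 :=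
    congrArg (fun σ : F.obj ⟶ tensorRight L ↦ σ.app _ (pres F).elt) hβ
  have h2 := (hk _ (kernelExtension.ι (t R) (op F))).symm.trans
    ((congrArg _ (kernelAdjunction_unit_elt (h := h) F)).symm.trans h1)
  have h3 : k = 0 := injective_app_of_mono (kernelExtension.ι (t R) (op F)) L
    (h2.trans (map_zero _).symm)
  ext M x
  obtain ⟨θ, rfl⟩ := (DREquiv _ _).surjective x
  refine (hk M θ).trans ?_
  rw [h3, map_zero]
  rfl

/-- An element `z` killed by the relations is the same as `α : E ⟶ - ⊗ L`. The composite `p ≫ α` is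
killed by the unit, hence zero, and `p` is surjective. -/
lemma isPureMono_of_unit_comp_eq_zero {E F : FP (RMod R)}
    (p : (DRfp R h).obj (op ((kernelExtension (t R)).obj (op F))) ⟶ E)
    (hp : ∀ A, Function.Surjective (p.hom.app A))
    (h0 : (kernelAdjunction R h).unit.app F ≫ p = 0) : IsPureMono (pres E).f := by
  intro L z hz
  obtain ⟨α, hα⟩ := (pres E).exists_hom (H := tensorRight L) z hz
  have h1 : p.hom ≫ α = 0 := by
    apply eq_zero_of_unit_comp_eq_zero F L
    have := congrArg (fun σ ↦ σ.hom) h0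
    change ((kernelAdjunction R h).unit.app F).hom ≫ p.hom = 0 at this
    rw [← Category.assoc, this, zero_comp]
  obtain ⟨y, hy⟩ := hp _ (pres E).elt
  rw [← hα, ← hy]
  exact congrArg (fun σ : _ ⟶ tensorRight L ↦ σ.app _ y) h1

end

/-- The comparison of `D_A` with the kernel extension of the tensor embedding, as functors to the
opposite category. -/
def DARightOpIso (R : Type u) [Ring R] : (DA R).rightOp ≅ (kernelExtension (t R)).rightOp :=
  NatIso.ofComponents (fun F ↦ ((DAIso R).app (op F)).op) fun {F G} φ ↦ by
    apply Quiver.Hom.unop_inj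
    exact ((DAIso R).hom.naturality φ.op).symm

/-- Units of adjunctions between `D_A` and `D_R` agree up to isomorphism with the unit of the
adjunction for the kernel extension of the tensor embedding. -/
lemma exists_iso_unit {h : ∀ G : (LFun R)ᵒᵖ, IsFP ((DR R).obj G)}
    (adj : (DA R).rightOp ⊣ DRfp R h) (F : FP (RMod R)) :
    ∃ ρ : (DRfp R h).obj (op ((DA R).obj (op F))) ≅
      (DRfp R h).obj (op ((kernelExtension (t R)).obj (op F))),
      adj.unit.app F ≫ ρ.hom = (kernelAdjunction R h).unit.app F := by
  let adj' := adj.ofNatIsoLeft (DARightOpIso R)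
  refine ⟨(DRfp R h).mapIso ((DARightOpIso R).app F) ≪≫
    (Adjunction.rightAdjointUniq adj' (kernelAdjunction R h)).app _, ?_⟩
  refine Eq.trans ?_
    (Adjunction.unit_rightAdjointUniq_hom_app adj' (kernelAdjunction R h) F)
  exact (Category.assoc _ _ _).symm

end Functors

/-! ### Objectwise kernels and cokernels -/

section Objectwise

variable {J : Type u₁} [Category.{v₁} J] {C : Type u₂} [Category.{v₂} C]
  {A B : J ⥤ C ⥤ AddCommGrpCat.{u}} (N : A ⟶ B)

lemma kernel_ι_app_injective (j : J) (c : C) :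
    Function.Injective (((kernel.ι N).app j).app c) := by
  rw [← AddCommGrpCat.mono_iff_injective]
  infer_instance

lemma cokernel_π_app_surjective (j : J) (c : C) :
    Function.Surjective (((cokernel.π N).app j).app c) := by
  rw [← AddCommGrpCat.epi_iff_surjective]
  infer_instance

lemma kernel_ι_app_exact (j : J) (c : C) :
    Function.Exact (((kernel.ι N).app j).app c) ((N.app j).app c) := by
  let S := ShortComplex.mk (kernel.ι N) N (kernel.condition N)
  have hS : S.Exact := S.exact_of_f_is_kernel (kernelIsKernel N)
  exact (ShortComplex.ab_exact_iff_function_exact _).1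
    ((hS.map ((evaluation _ _).obj j)).map ((evaluation _ _).obj c))

lemma cokernel_π_app_exact (j : J) (c : C) :
    Function.Exact ((N.app j).app c) (((cokernel.π N).app j).app c) := by
  let S := ShortComplex.mk N (cokernel.π N) (cokernel.condition N)
  have hS : S.Exact := S.exact_of_g_is_cokernel (cokernelIsCokernel N)
  exact (ShortComplex.ab_exact_iff_function_exact _).1
    ((hS.map ((evaluation _ _).obj j)).map ((evaluation _ _).obj c))

end Objectwise

/-! ### Functorial kernels and cokernels inside `FP C`. -/

section

variable {C : Type u₁} [Category.{v₁} C] [Preadditive C]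
  {D : Type u₂} [Category.{v₂} D] {S T : D ⥤ FP C} (η : S ⟶ T)

section

variable [HasPushouts C]

/-- The objectwise kernel of a transformation between functors with values in `FP C`. -/
def kernelFP : D ⥤ FP C :=
  -- Taking the kernel in the category of functor-valued functors provides functoriality; only
  -- finite presentation of each value is left to check.
  ObjectProperty.lift IsFP (kernel (Functor.whiskerRight η (ObjectProperty.ι IsFP))) fun F ↦
    IsFP.of_kernel _ _ (kernel_ι_app_injective _ F) (kernel_ι_app_exact _ F) (S.obj F).property
      (T.obj F).property

/-- The inclusion of the kernel. -/
def kernelFPι : kernelFP η ⟶ S where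
  app F := ObjectProperty.homMk
    ((kernel.ι (Functor.whiskerRight η (ObjectProperty.ι IsFP))).app F)
  naturality F G φ := by
    ext : 1
    exact (kernel.ι (Functor.whiskerRight η (ObjectProperty.ι IsFP))).naturality φ

lemma kernelFPι_comp : kernelFPι η ≫ η = 0 := by
  ext F : 3
  exact congrArg (fun σ ↦ σ.app F)
    (kernel.condition (Functor.whiskerRight η (ObjectProperty.ι IsFP)))

end

section

variable [HasBinaryBiproducts C]

/-- The objectwise cokernel of a transformation between functors with values in `FP C`. -/
def cokernelFP : D ⥤ FP C :=
  ObjectProperty.lift IsFP (cokernel (Functor.whiskerRight η (ObjectProperty.ι IsFP))) fun F ↦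
    IsFP.of_cokernel _ _ (cokernel_π_app_exact _ F) (cokernel_π_app_surjective _ F)
      (S.obj F).property (T.obj F).property

/-- The projection to the cokernel. -/
def cokernelFPπ : T ⟶ cokernelFP η where
  app F := ObjectProperty.homMk
    ((cokernel.π (Functor.whiskerRight η (ObjectProperty.ι IsFP))).app F)
  naturality F G φ := by
    ext : 1
    exact (cokernel.π (Functor.whiskerRight η (ObjectProperty.ι IsFP))).naturality φ

lemma comp_cokernelFPπ : η ≫ cokernelFPπ η = 0 := by
  ext F : 3
  exact congrArg (fun σ ↦ σ.app F)
    (cokernel.condition (Functor.whiskerRight η (ObjectProperty.ι IsFP)))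

end

end

lemma isFourTermExact {R : Type u} [Ring R] {S T : FP (RMod R) ⥤ FP (RMod R)} (η : S ⟶ T)
    (F : FP (RMod R)) :
    IsFourTermExact ((kernelFPι η).app F) (η.app F) ((cokernelFPπ η).app F) where
  injective := kernel_ι_app_injective _ F
  exact₂ := kernel_ι_app_exact _ F
  exact₃ := cokernel_π_app_exact (Functor.whiskerRight η (ObjectProperty.ι IsFP)) F
  surjective := cokernel_π_app_surjective _ F

end

end AGJ

theorem mainTheorem9 (R : Type u) [Ring R] :
    ∃ hfp : ∀ G : (AGJ.LFun R)ᵒᵖ, AGJ.IsFP ((AGJ.DR R).obj G),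
      Nonempty ((AGJ.DA R).rightOp ⊣ AGJ.DRfp R hfp) ∧
      ∀ adj : (AGJ.DA R).rightOp ⊣ AGJ.DRfp R hfp,
        ∃ (lowerQ upperQ : AGJ.FP (AGJ.RMod R) ⥤ AGJ.FP (AGJ.RMod R))
          (ι : lowerQ ⟶ 𝟭 (AGJ.FP (AGJ.RMod R)))
          (p : (AGJ.DA R).rightOp ⋙ AGJ.DRfp R hfp ⟶ upperQ),
          ∀ F : AGJ.FP (AGJ.RMod R),
            AGJ.IsFourTermExact (ι.app F) (adj.unit.app F) (p.app F) ∧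
            IsZero ((AGJ.DA R).obj (op (lowerQ.obj F))) ∧
            IsZero ((AGJ.DA R).obj (op (upperQ.obj F))) ∧
            AGJ.ArisesFromPureExact (lowerQ.obj F).obj ∧
            AGJ.ArisesFromPureExact (upperQ.obj F).obj := by
  refine ⟨AGJ.isFP_DR, ⟨(AGJ.kernelAdjunction R AGJ.isFP_DR).ofNatIsoLeft
    (AGJ.DARightOpIso R).symm⟩, fun adj ↦ ⟨AGJ.kernelFP adj.unit, AGJ.cokernelFP adj.unit,
      AGJ.kernelFPι adj.unit, AGJ.cokernelFPπ adj.unit, fun F ↦ ?_⟩⟩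
  have hex := AGJ.isFourTermExact adj.unit F
  -- The purity lemmas concern the explicit unit; `ρ` carries the kernel and cokernel of the given
  -- unit over to it.
  obtain ⟨ρ, hρ⟩ := AGJ.exists_iso_unit adj F
  have h1 : (AGJ.kernelFPι adj.unit).app F ≫ adj.unit.app F = 0 :=
    congrArg (fun σ ↦ σ.app F) (AGJ.kernelFPι_comp adj.unit)
  have h2 : adj.unit.app F ≫ (AGJ.cokernelFPπ adj.unit).app F = 0 :=
    congrArg (fun σ ↦ σ.app F) (AGJ.comp_cokernelFPπ adj.unit)
  have hl := AGJ.isPureMono_of_comp_unit_eq_zero (h := AGJ.isFP_DR)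
    ((AGJ.kernelFPι adj.unit).app F) hex.injective (by
      refine (congrArg (_ ≫ ·) hρ.symm).trans ?_
      refine (Category.assoc _ _ _).symm.trans ?_
      exact (congrArg (· ≫ ρ.hom) h1).trans zero_comp)
  have hu := AGJ.isPureMono_of_unit_comp_eq_zero (h := AGJ.isFP_DR)
    (ρ.inv ≫ (AGJ.cokernelFPπ adj.unit).app F) (fun A x ↦ by
      obtain ⟨y, rfl⟩ := hex.surjective A x
      refine ⟨ρ.hom.hom.app A y, ?_⟩
      have := congrArg (fun σ ↦ σ.hom.app A y)
        (ρ.hom_inv_id_assoc ((AGJ.cokernelFPπ adj.unit).app F))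
      exact this) (by
      rw [← hρ, Category.assoc, Iso.hom_inv_id_assoc]
      exact h2)
  exact ⟨hex, AGJ.isZero_DA hl, AGJ.isZero_DA hu, hl.arisesFromPureExact, hu.arisesFromPureExact⟩
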